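/- Let $G$ be a finite simple bipartite graph on the vertex set $[d]=\{1,\dots,d\}$ with a bipartition $[d]=V_1\sqcup V_2$ (parts may be empty, and isolated vertices are allowed), and let $\widehat G$ be the connected bipartite graph on $[d+2]$ with edge set $$E(\widehat G)=E(G)\cup\{\{i,d+1\}: i\in V_1\}\cup\{\{j,d+2\}: j\in V_2\cup\{d+1\}\}.$$ For a hypergraph $\mathcal H=(V,E)$, where $V$ is a finite set and $E=\{e_1,\dots,e_n\}$ is a finite multiset of non-empty subsets of $V$, let $\mathrm{Bip}\,\mathcal H$ be the bipartite graph on $V\sqcup E$ in which $v\in V$ and $e\in E$ are adjacent if and only if $v\in e$. A hypertree of $\mathcal H$ is a function $\mathbf f:E\to\{0,1,\dots\}$ for which some spanning tree of $\mathrm{Bip}\,\mathcal H$ has degree $\mathbf f(e)+1$ at every $e\in E$. A hyperedge $e_j$ is internally inactive with respect to a hypertree $\mathbf f$ if for some $j'<j$ the function obtained from $\mathbf f$ by decreasing $\mathbf f(e_j)$ by $1$ and increasing $\mathbf f(e_{j'})$ by $1$ is again a hypertree. Let $\overline\iota(\mathbf f)$ be the number of internally inactive hyperedges with respect to $\mathbf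 f$. The interior polynomial of $\mathcal H$ is $I_{\mathcal H}(x)=\sum_{\mathbf f}x^{\overline\iota(\mathbf f)}$, the sum over all hypertrees of $\mathcal H$; if $\mathrm{Bip}\,\mathcal H$ is isomorphic to a connected bipartite graph $K$, one sets $I_K(x)=I_{\mathcal H}(x)$. A $k$-matching of $G$ is a set of $k$ pairwise disjoint edges of $G$. Let $M(G,k)$ be the set of all subsets of $[d]$ that are the vertex set (the set of endpoints of the edges) of some $k$-matching of $G$; in particular $M(G,0)=\{\emptyset\}$. Then $$I_{\widehat G}(x)=\sum_{k\ge 0}|M(G,k)|\,x^k .$$ That is, for every hypergraph $\mathcal H$ with $\mathrm{Bip}\,\mathcal H\cong\widehat G$ and every ordering of its hyperedges, $I_{\mathcal H}(x)=\sum_{k\ge0}|M(G,k)|\,x^k$. -/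

import Mathlib

open Polynomial

/-- A hypergraph with vertex set `α`, whose multiset of non-empty hyperedges is given as a family
indexed by `ε` (so equal hyperedges may occur for different indices). -/
structure MultiHypergraph (α ε : Type*) where
  /-- The set of vertices of a hyperedge. -/
  edge : ε → Set α
  /-- Hyperedges are non-empty. -/
  edge_nonempty : ∀ e, (edge e).Nonempty

namespace MultiHypergraph

variable {α ε : Type*}

/-- The bipartite graph `Bip H` on the disjoint union of vertices and hyperedges, where a vertex is
joined to the hyperedges that contain it. -/
def bip (H : MultiHypergraph α ε) : SimpleGraph (α ⊕ ε) :=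
  SimpleGraph.fromEdgeSet {s | ∃ v e, v ∈ H.edge e ∧ s = s(Sum.inl v, Sum.inr e)}

/-- `Γ` is a spanning tree of `Bip H` that induces `f`: it has degree `f e + 1` at each
hyperedge `e`. -/
def Induces (H : MultiHypergraph α ε) (Γ : SimpleGraph (α ⊕ ε)) (f : ε → ℕ) : Prop :=
  Γ ≤ H.bip ∧ Γ.IsTree ∧ ∀ e, (Γ.neighborSet (Sum.inr e)).ncard = f e + 1

/-- The set of hypertrees of `H`. -/
def hypertrees (H : MultiHypergraph α ε) : Set (ε → ℕ) :=
  {f | ∃ Γ : SimpleGraph (α ⊕ ε), H.Induces Γ f}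

theorem hypertrees_finite [Finite α] [Finite ε] (H : MultiHypergraph α ε) :
    H.hypertrees.Finite := by
  refine Set.Finite.subset
    (Set.Finite.pi' fun _ : ε => Set.finite_Iic (Nat.card (α ⊕ ε))) ?_
  rintro f ⟨Γ, -, -, h⟩ e
  have h1 : (Γ.neighborSet (Sum.inr e)).ncard ≤ Nat.card (α ⊕ ε) := Set.ncard_le_card _
  have h2 := h e
  exact Set.mem_Iic.2 (by omega)

/-- The hyperedge `e` is internally inactive with respect to `f`: for some smaller hyperedge `e'`,
decreasing `f e` by one and increasing `f e'` by one gives another hypertree `g`. -/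
def InternallyInactive [LinearOrder ε] (H : MultiHypergraph α ε) (f : ε → ℕ) (e : ε) : Prop :=
  ∃ e' < e, ∃ g ∈ H.hypertrees,
    g e + 1 = f e ∧ g e' = f e' + 1 ∧ ∀ e'', e'' ≠ e → e'' ≠ e' → g e'' = f e''

/-- The interior polynomial of `H`, with respect to the given ordering of the hyperedges. -/
noncomputable def interiorPolynomial [Finite α] [Finite ε] [LinearOrder ε]
    (H : MultiHypergraph α ε) : ℤ[X] :=
  ∑ f ∈ H.hypertrees_finite.toFinset, X ^ {e | H.InternallyInactive f e}.ncard

end MultiHypergraph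

/-- The graph `Ĝ` for a bipartite graph `G` with parts `V₁` and `V₂`. For `V = [d]`, the two new
vertices `inr 0` and `inr 1` are `d + 1` and `d + 2`. -/
def hatGraph {V : Type*} (G : SimpleGraph V) (V₁ V₂ : Set V) : SimpleGraph (V ⊕ Fin 2) :=
  SimpleGraph.fromEdgeSet
    (Sym2.map Sum.inl '' G.edgeSet ∪
      {s | ∃ i ∈ Sum.inl '' V₁, s = s(i, Sum.inr 0)} ∪
      {s | ∃ j ∈ Sum.inl '' V₂ ∪ {Sum.inr 0}, s = s(j, Sum.inr 1)})

/-- The set `M(G, k)` of vertex sets of `k`-matchings of `G`. -/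
def matchingVertexSets {V : Type*} (G : SimpleGraph V) (k : ℕ) : Set (Set V) :=
  {S | ∃ M : G.Subgraph, M.IsMatching ∧ M.edgeSet.ncard = k ∧ M.verts = S}

/-! ### Simple hyperplane arrangements and vanishing at their vertices -/

section Arrangement

variable {K E ι : Type*} [Field K] [Infinite K] [AddCommGroup E] [Module K E]

/-! Interchanging the parts if necessary, let d+1 correspond to a hyperedge `r`. Then `r` contains
every vertex, d+2 corresponds to a vertex `s` lying in every hyperedge, and the other vertices and
hyperedges form `V₁` and `V₂`. Rooting a spanning tree at `s` and sending each vertex to its parent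
shows that hypertrees are the fibre counts of functions that send each v ≠ s to a hyperedge
containing it; conversely, such a function together with the star at `s` gives a tree.

By Hall's theorem these counts are the integer points of the base polytope of a supermodular
function. Exchanging two consecutive elements of the order preserves the distribution of the number
of inactive elements, by an involution that reverses certain lines (`sum_inactive_eq_of_swap`). So
`r` may be taken least, and then e is inactive exactly when e ≠ r and f(e) ≠ 0
(`interiorPolynomial_eq_sum_support`): the coefficient of x^k counts the hypertrees with k support
elements outside `r`.

For fixed support T ⊆ V₂, these correspond to the positive fibre counts f of partial functions from
V₁ to T. They are as numerous as the sets S ⊆ V₁ matched perfectly to T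
(`card_partialFiberCount_eq_card_saturates`), and the unions S ∪ T with |T| = k are the vertex sets
of k-matchings. The equality is a dimension count. Give each v ∈ V₁ a generic hyperplane l_v = c_v
in ℚ^T, where l_v involves only the coordinates adjacent to v; the vertices of this arrangement
correspond to the sets S. Evaluation at the vertices is an isomorphism on the span of the monomials
x^(f-1). It is onto because the products of l_v - c_v over v ∉ S interpolate. It is injective
because along each direction such a polynomial has degree less than the number of transversal
hyperplanes, so vanishing spreads from vertices to flats of growing dimension. -/

theorem exists_forall_apply_ne_zero [Finite ι] (L : ι → E →ₗ[K] K) (hL : ∀ i, L i ≠ 0) :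
    ∃ x, ∀ i, L i x ≠ 0 := by
  classical
  have := Fintype.ofFinite ι
  have h := Subspace.biUnion_ne_univ_of_top_notMem (k := K) (E := E)
    (s := Finset.univ.image fun i => LinearMap.ker (L i)) (by simpa [LinearMap.ker_eq_top] using hL)
  rw [Set.ne_univ_iff_exists_notMem] at h
  obtain ⟨x, hx⟩ := h
  refine ⟨x, fun i hi => hx ?_⟩
  simp only [Set.mem_iUnion]
  exact ⟨_, Finset.mem_image_of_mem _ (Finset.mem_univ i), hi⟩

theorem exists_ne_zero_forall_apply_ne_zero [Finite ι] [Nontrivial E] (L : ι → E →ₗ[K] K)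
    (hL : ∀ i, L i ≠ 0) : ∃ x, x ≠ 0 ∧ ∀ i, L i x ≠ 0 := by
  obtain ⟨y, hy⟩ := exists_ne (0 : E)
  obtain ⟨g, hg⟩ : ∃ g : E →ₗ[K] K, g y ≠ 0 := by
    by_contra! h
    exact hy ((Module.forall_dual_apply_eq_zero_iff K y).1 h)
  have hg0 : g ≠ 0 := by rintro rfl; simp at hg
  obtain ⟨x, hx⟩ := exists_forall_apply_ne_zero (fun o : Option ι => o.elim g L)
    (by rintro (_ | i); exacts [hg0, hL i])
  exact ⟨x, fun h => hx none (by simp [h]), fun i => hx (some i)⟩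

/-- A function that has, along each direction, degree less than the number of hyperplanes of a
simple arrangement transversal to that direction, is determined by its values at the vertices of
the arrangement. -/
theorem eq_zero_of_vanishes_at_vertices [FiniteDimensional K E] [Fintype ι]
    (l : ι → E →ₗ[K] K) (c : ι → K)
    (hs : ∀ x, LinearIndepOn K l {i | l i x = c i}) (p : E → K)
    (hp : ∀ x η, η ≠ 0 → ∃ q : K[X], q.degree < ({i | l i η ≠ 0} : Set ι).ncard ∧
      ∀ s : K, p (x + s • η) = q.eval s)
    (hv : ∀ x, (∀ η, (∀ i, l i x = c i → l i η = 0) → η = 0) → p x = 0) (x : E) : p x = 0 := by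
  classical
  -- Induction on the dimension of the flat cut out by the hyperplanes in `A`; `A = ∅` is the whole
  -- space.
  suffices H : ∀ n, ∀ A : Finset ι, Module.finrank K (⨅ i : A, LinearMap.ker (l i) : Submodule K E) = n →
      ∀ x, (∀ i ∈ A, l i x = c i) → p x = 0 from H _ ∅ rfl x (by simp)
  intro n
  induction n using Nat.strong_induction_on with
  | _ n ih =>
  intro A hA x hx
  set U : Submodule K E := ⨅ i : A, LinearMap.ker (l i) with hU
  have memU : ∀ {η}, η ∈ U ↔ ∀ i ∈ A, l i η = 0 := by
    intro η; simp [hU, Submodule.mem_iInf]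
  have key : ∀ i, (∃ η ∈ U, l i η ≠ 0) → ∀ y, (∀ j ∈ A, l j y = c j) → l i y = c i → p y = 0 := by
    rintro i ⟨η, hηU, hη⟩ y hy hiy
    refine ih _ ?_ (insert i A) rfl y (by simpa [hiy] using hy)
    rw [← hA]
    apply Submodule.finrank_lt_finrank_of_lt
    refine lt_of_le_of_ne ?_ ?_
    · intro z hz
      rw [memU]
      intro j hj
      have := (Submodule.mem_iInf _).1 hz ⟨j, Finset.mem_insert_of_mem hj⟩
      simpa using this
    · intro h
      rw [← h] at hηU
      have := (Submodule.mem_iInf _).1 hηU ⟨i, Finset.mem_insert_self i A⟩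
      exact hη (by simpa using this)
  by_cases hbot : U = ⊥
  · refine hv x fun η hη => ?_
    have : η ∈ U := memU.2 fun i hi => hη i (hx i hi)
    simpa [hbot] using this
  have : Nontrivial U := Submodule.nontrivial_iff_ne_bot.2 hbot
  by_cases hon : ∃ i, (∃ η ∈ U, l i η ≠ 0) ∧ l i x = c i
  · obtain ⟨i, h1, h2⟩ := hon
    exact key i h1 x hx h2
  push Not at hon
  let B := {i : ι // ∃ η ∈ U, l i η ≠ 0}
  have hd : ∀ i : B, c i - l i x ≠ 0 := fun i h => hon i i.2 (sub_eq_zero.1 h).symm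
  -- The direction has to avoid the zeros of two kinds of forms: the first make the line meet each
  -- hyperplane of `B`, the second keep the meeting points with two of them distinct.
  let L : B ⊕ {q : B × B // q.1 ≠ q.2} → U →ₗ[K] K := Sum.elim (fun i => (l i).domRestrict U)
    (fun q => ((c q.1.2 - l q.1.2 x) • l q.1.1 - (c q.1.1 - l q.1.1 x) • l q.1.2).domRestrict U)
  obtain ⟨η, hη0, hη⟩ := exists_ne_zero_forall_apply_ne_zero L (by
    rintro (⟨i, η, hηU, hη⟩ | ⟨⟨i, j⟩, hij⟩) h0
    · exact hη (by simpa [L] using LinearMap.congr_fun h0 ⟨η, hηU⟩)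
    -- Otherwise hyperplanes `i` and `j` have the same trace on the flat. At a point `y` of that
    -- trace, `l i` lies in the span of `l j` and the forms of `A`, against simplicity.
    · have hprop : ∀ η ∈ U, (c j - l j x) * l i η = (c i - l i x) * l j η := fun η hη => by
        simpa [L, sub_eq_zero] using LinearMap.congr_fun h0 ⟨η, hη⟩
      obtain ⟨η, hηU, hη⟩ := i.2
      set y := x + ((c i - l i x) / l i η) • η with hy
      have h1 : l i y = c i := by simp [hy, div_mul_cancel₀ _ hη]
      have h2 : l j y = c j := by
        have := hprop η hηU
        simp only [hy, map_add, map_smul, smul_eq_mul]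
        rw [div_mul_eq_mul_div, ← this, mul_div_assoc, div_self hη]; ring
      have h3 : ∀ k ∈ A, l k y = c k := fun k hk => by
        simp [hy, hx k hk, memU.1 hηU k hk]
      have hspan : ((c j - l j x) • l i - (c i - l i x) • l j) ∈
          Submodule.span K (Set.range fun k : A => l k) := by
        apply mem_span_of_iInf_ker_le_ker
        intro z hz
        have := hprop z hz
        simp [this]
      have hmem : l i ∈ Submodule.span K (l '' ({k | l k y = c k} \ {i.1})) := by
        have hle : Submodule.span K (Set.range fun k : A => l k) ≤
            Submodule.span K (l '' ({k | l k y = c k} \ {i.1})) := by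
          apply Submodule.span_mono
          rintro _ ⟨k, rfl⟩
          refine ⟨k, ⟨h3 k k.2, fun h => hη ?_⟩, rfl⟩
          rw [← Set.mem_singleton_iff.1 h]; exact memU.1 hηU k k.2
        have hj : l j ∈ Submodule.span K (l '' ({k | l k y = c k} \ {i.1})) :=
          Submodule.subset_span ⟨j, ⟨h2, fun h => hij (Subtype.ext h.symm)⟩, rfl⟩
        have := Submodule.add_mem _ (hle hspan) (Submodule.smul_mem _ (c i - l i x) hj)
        rw [sub_add_cancel] at this
        exact (Submodule.smul_mem_iff _ (hd j)).1 this
      exact (linearIndepOn_iff_notMem_span.1 (hs y)) i h1 hmem)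
  obtain ⟨q, hq, hpq⟩ := hp x η (by simpa using hη0)
  have hB : ({i | l i η ≠ 0} : Set ι).ncard = (Finset.univ : Finset B).card := by
    rw [Finset.card_univ, ← Nat.card_eq_fintype_card, ← Nat.card_coe_set_eq]
    refine Nat.card_congr (Equiv.subtypeEquivRight fun i => ⟨fun h => ⟨η, η.2, h⟩, fun h => ?_⟩)
    exact hη (Sum.inl ⟨i, h⟩)
  -- `q` vanishes at one parameter for each hyperplane in `B`, more often than its degree allows.
  have hq0 : q = 0 := by
    refine Polynomial.eq_zero_of_degree_lt_of_eval_index_eq_zero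
      (v := fun i : B => (c i - l i x) / l i η) Finset.univ ?_ (hB ▸ hq) ?_
    · intro i _ j _ h
      by_contra hij
      have h1 : l i η ≠ 0 := hη (Sum.inl i)
      have h2 : l j η ≠ 0 := hη (Sum.inl j)
      refine hη (Sum.inr ⟨(i, j), hij⟩) ?_
      simp only [div_eq_div_iff h1 h2] at h
      simp only [L, Sum.elim_inr, LinearMap.domRestrict_apply, LinearMap.sub_apply,
        LinearMap.smul_apply, smul_eq_mul]
      rw [h]; ring
    · intro i _
      have h1 : l i η ≠ 0 := hη (Sum.inl i)
      rw [← hpq]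
      refine key i i.2 _ ?_ (by simp [div_mul_cancel₀ _ h1])
      intro k hk
      simp [hx k hk, memU.1 η.2 k hk]
  simpa [hq0] using hpq 0

/-- Generic translates of finitely many hyperplanes form a simple arrangement. -/
theorem exists_simple_arrangement [Fintype ι] (l : ι → E →ₗ[K] K) :
    ∃ c : ι → K, ∀ x, LinearIndepOn K l {i | l i x = c i} := by
  classical
  let D := {A : Finset ι // ¬ LinearIndepOn K l A}
  have hD : ∀ A : D, ∃ g : ι → K, g ≠ 0 ∧ (∀ i ∉ A.1, g i = 0) ∧ ∑ i, g i • l i = 0 := by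
    rintro ⟨A, hA⟩
    rw [linearIndepOn_finset_iff] at hA
    push Not at hA
    obtain ⟨g, hg, i, hi, hgi⟩ := hA
    refine ⟨fun i => if i ∈ A then g i else 0, fun h => hgi ?_, fun i hi => by simp [hi], ?_⟩
    · simpa [hi] using congr_fun h i
    · simpa [ite_smul, Finset.sum_ite_mem] using hg
  choose g hg0 hgA hg using hD
  -- The chosen relation among each dependent family of forms must fail for the constants;
  -- hyperplanes through a common point would make it hold.
  obtain ⟨c, hc⟩ := exists_forall_apply_ne_zero
    (fun A : D => (∑ i, g A i • LinearMap.proj i : (ι → K) →ₗ[K] K)) (by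
      intro A h
      refine hg0 A (funext fun i => ?_)
      have := LinearMap.congr_fun h (Pi.single i 1)
      simpa [LinearMap.sum_apply, Pi.single_apply] using this)
  refine ⟨c, fun x => ?_⟩
  by_contra h
  have hc' := hc ⟨Finset.univ.filter fun i => l i x = c i, by simpa using h⟩
  apply hc'
  have h0 := LinearMap.congr_fun (hg ⟨Finset.univ.filter fun i => l i x = c i, by simpa using h⟩) x
  simp only [LinearMap.sum_apply, LinearMap.smul_apply, smul_eq_mul, LinearMap.zero_apply] at h0
  simp only [LinearMap.sum_apply, LinearMap.smul_apply, smul_eq_mul, LinearMap.proj_apply]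
  rw [← h0]
  refine Finset.sum_congr rfl fun i _ => ?_
  by_cases hi : l i x = c i
  · rw [hi]
  · rw [hgA _ i (by simpa using hi)]; simp

end Arrangement

/-! ### Generic forms supported on a relation -/

section TransversalCount

variable {A B : Type*}

/-- `S` is matched perfectly to the whole of `B` along the relation `adj`. -/
def Saturates (adj : A → B → Prop) (S : Set A) : Prop :=
  ∃ σ : B → A, Function.Injective σ ∧ (∀ t, adj (σ t) t) ∧ Set.range σ = S

/-- `f` counts the fibres of a partial function from `A` to `B` along the relation `adj`. -/
def IsPartialFiberCount (adj : A → B → Prop) (f : B → ℕ) : Prop :=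
  ∃ φ : A → Option B, (∀ v t, φ v = some t → adj v t) ∧ ∀ t, f t = {v | φ v = some t}.ncard

/-- The coefficients `a` are supported on `adj` and otherwise generic. -/
def IsGenericFor [Fintype B] [DecidableEq B] (adj : A → B → Prop) (a : A → B → ℚ) : Prop :=
  (∀ v t, ¬ adj v t → a v t = 0) ∧
    ∀ (S : Finset B) (σ : B → A), Set.InjOn σ S → (∀ t ∈ S, adj (σ t) t) →
        (Matrix.of fun i j : S => a (σ i) j).det ≠ 0

/-- With indeterminate entries each determinant is a nonzero polynomial: setting the matched entries
to 1 and the others to 0 gives the identity matrix. A point where the product of these finitely many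
polynomials is nonzero serves all of them. -/
theorem exists_generic_coefficients [Finite A] [Fintype B] [DecidableEq B]
    (adj : A → B → Prop) : ∃ a : A → B → ℚ, IsGenericFor adj a := by
  classical
  have := Fintype.ofFinite A
  let M : A → B → MvPolynomial (A × B) ℚ := fun v t => if adj v t then MvPolynomial.X (v, t) else 0
  let D : Finset B × (B → A) → MvPolynomial (A × B) ℚ := fun q =>
    (Matrix.of fun i j : q.1 => M (q.2 i) j).det
  let good : Finset (Finset B × (B → A)) :=
    Finset.univ.filter fun q => Set.InjOn q.2 q.1 ∧ ∀ t ∈ q.1, adj (q.2 t) t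
  have hev : ∀ (x : A × B → ℚ) q, MvPolynomial.eval x (D q) =
      (Matrix.of fun i j : q.1 => if adj (q.2 i) j then x (q.2 i, j) else 0).det := by
    intro x q
    rw [RingHom.map_det]
    congr 1
    ext i j
    simp only [M, RingHom.mapMatrix_apply, Matrix.map_apply, Matrix.of_apply]
    split_ifs <;> simp
  have hD : ∀ q ∈ good, D q ≠ 0 := by
    intro q hq h0
    obtain ⟨hinj, hadj⟩ := (Finset.mem_filter.1 hq).2
    have h1 := hev (fun p => if p.2 ∈ q.1 ∧ q.2 p.2 = p.1 then 1 else 0) q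
    rw [h0, map_zero] at h1
    have : (Matrix.of fun i j : q.1 => if adj (q.2 i) j then
        (if (j : B) ∈ q.1 ∧ q.2 j = q.2 i then (1 : ℚ) else 0) else 0) = 1 := by
      ext i j
      rw [Matrix.of_apply, Matrix.one_apply]
      by_cases hij : i = j
      · subst hij; simp [hadj i i.2]
      · have : q.2 j ≠ q.2 i := fun h => hij (Subtype.ext (hinj i.2 j.2 h.symm))
        simp [hij, this]
    rw [this, Matrix.det_one] at h1
    exact zero_ne_one h1
  obtain ⟨x, hx⟩ : ∃ x, MvPolynomial.eval x (∏ q ∈ good, D q) ≠ 0 := by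
    by_contra! h
    exact Finset.prod_ne_zero_iff.2 hD (MvPolynomial.funext (by simpa using h))
  rw [map_prod, Finset.prod_ne_zero_iff] at hx
  refine ⟨fun v t => if adj v t then x (v, t) else 0, fun v t h => if_neg h, fun S σ h1 h2 => ?_⟩
  have := hx (S, σ) (Finset.mem_filter.2 ⟨Finset.mem_univ _, h1, h2⟩)
  rwa [hev] at this

variable [Fintype B] [DecidableEq B] {adj : A → B → Prop} {a : A → B → ℚ}

theorem IsGenericFor.eq_zero (ha : IsGenericFor adj a) {S : Finset B} {σ : B → A}
    (hσ : Set.InjOn σ S) (hadj : ∀ t ∈ S, adj (σ t) t) {η : B → ℚ}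
    (hout : ∀ i ∈ S, ∀ j ∉ S, a (σ i) j * η j = 0)
    (hη : ∀ i ∈ S, ∑ j, a (σ i) j * η j = 0) : ∀ j ∈ S, η j = 0 := by
  have hdet := ha.2 S σ hσ hadj
  by_contra! h
  obtain ⟨j, hj, hj0⟩ := h
  refine hdet (Matrix.exists_mulVec_eq_zero_iff.1 ⟨fun j : S => η j, ?_, ?_⟩)
  · exact fun h => hj0 (congr_fun h ⟨j, hj⟩)
  · ext i
    simp only [Matrix.mulVec, dotProduct, Matrix.of_apply, Pi.zero_apply]
    rw [Finset.sum_coe_sort S (fun j => a (σ i) j * η j), ← hη i i.2]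
    exact Finset.sum_subset (Finset.subset_univ _) fun j _ hj => hout i i.2 j hj

/-- Among the forms that involve a coordinate in the support of `η`, fewer than the size of that
support vanish at `η`. -/
theorem IsGenericFor.card_vanishing_lt [Finite A] (ha : IsGenericFor adj a) {η : B → ℚ}
    (hη : η ≠ 0) :
    {v | (∃ t, η t ≠ 0 ∧ adj v t) ∧ ∑ t, a v t * η t = 0}.ncard < {t | η t ≠ 0}.ncard := by
  classical
  have := Fintype.ofFinite A
  let S : Finset B := Finset.univ.filter fun t => η t ≠ 0
  let Z : Finset A := Finset.univ.filter fun v =>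
    (∃ t, η t ≠ 0 ∧ adj v t) ∧ ∑ t, a v t * η t = 0
  have hS : {t | η t ≠ 0}.ncard = S.card := by rw [← Set.ncard_coe_finset]; simp [S]
  have hZ : {v | (∃ t, η t ≠ 0 ∧ adj v t) ∧ ∑ t, a v t * η t = 0}.ncard = Z.card := by
    rw [← Set.ncard_coe_finset]; simp [Z]
  have hSne : S.Nonempty := by
    obtain ⟨t, ht⟩ := Function.ne_iff.1 hη
    exact ⟨t, by simpa [S] using ht⟩
  rw [hS, hZ]
  by_contra! hle
  let nb : Finset A → Finset B := fun R => S.filter fun t => ∃ v ∈ R, adj v t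
  have nbmono : ∀ {R R'}, R ⊆ R' → nb R ⊆ nb R' := by
    intro R R' h t ht
    simp only [nb, Finset.mem_filter] at ht ⊢
    obtain ⟨h1, v, hv, h2⟩ := ht
    exact ⟨h1, v, h hv, h2⟩
  have hZne : Z.Nonempty := Finset.card_pos.1 (hSne.card_pos.trans_le hle)
  -- A smallest nonempty `R` with at most `R.card` neighbours in `S`. Minimality gives Hall's
  -- condition and `(nb R).card = R.card`, so `R` is matched perfectly to `nb R`. The forms in `R`
  -- see no nonzero coordinate of `η` outside `nb R`, and genericity makes `η` vanish on `nb R ⊆ S`.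
  obtain ⟨R, hR, hmin⟩ := Finset.exists_min_image
    (Z.powerset.filter fun R => R.Nonempty ∧ (nb R).card ≤ R.card) Finset.card
    ⟨Z, by
      simp only [Finset.mem_filter, Finset.mem_powerset, subset_refl, true_and]
      exact ⟨hZne, (Finset.card_le_card (Finset.filter_subset _ _)).trans hle⟩⟩
  simp only [Finset.mem_filter, Finset.mem_powerset] at hR hmin
  obtain ⟨hRZ, hRne, hRle⟩ := hR
  have hlt : ∀ R', R' ⊆ R → R'.Nonempty → R'.card < R.card → R'.card < (nb R').card := by
    intro R' h1 h2 h3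
    by_contra! h4
    exact absurd (hmin R' ⟨h1.trans hRZ, h2, h4⟩) (not_le.2 h3)
  have hnbne : (nb R).Nonempty := by
    obtain ⟨v, hv⟩ := hRne
    obtain ⟨⟨t, ht, hvt⟩, -⟩ := (Finset.mem_filter.1 (hRZ hv)).2
    exact ⟨t, by simp only [nb, S, Finset.mem_filter, Finset.mem_univ, true_and]; exact ⟨ht, v, hv, hvt⟩⟩
  have hReq : (nb R).card = R.card := by
    refine le_antisymm hRle ?_
    by_contra! h
    obtain ⟨v, hv⟩ := hRne
    have hc := Finset.card_erase_of_mem hv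
    rcases (R.erase v).eq_empty_or_nonempty with h0 | h0
    · rw [h0, Finset.card_empty] at hc
      have := hnbne.card_pos
      omega
    · have h1 := hlt _ (Finset.erase_subset v R) h0 (by have := Finset.card_pos.2 ⟨v, hv⟩; omega)
      have h2 := Finset.card_le_card (nbmono (Finset.erase_subset v R))
      omega
  have hall : ∀ s : Finset R, s.card ≤ (s.biUnion fun v => S.filter fun t => adj v t).card := by
    intro s
    rcases s.eq_empty_or_nonempty with rfl | hs
    · simp
    have hb : (s.biUnion fun v => S.filter fun t => adj v t) = nb (s.map (Function.Embedding.subtype _)) := by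
      ext t
      simp only [nb, Finset.mem_biUnion, Finset.mem_filter, Finset.mem_map,
        Function.Embedding.coe_subtype]
      constructor
      · rintro ⟨v, hv, h1, h2⟩; exact ⟨h1, v, ⟨v, hv, rfl⟩, h2⟩
      · rintro ⟨h1, _, ⟨v, hv, rfl⟩, h2⟩; exact ⟨v, hv, h1, h2⟩
    rw [hb, ← Finset.card_map (Function.Embedding.subtype _)]
    have hsub : s.map (Function.Embedding.subtype (· ∈ R)) ⊆ R := by
      intro v hv
      obtain ⟨w, -, rfl⟩ := Finset.mem_map.1 hv
      exact w.2
    rcases (Finset.card_le_card hsub).lt_or_eq with h | h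
    · exact (hlt _ hsub (by simpa using hs) h).le
    · rw [Finset.eq_of_subset_of_card_le hsub h.ge, hReq]
  obtain ⟨m, hminj, hm⟩ := (Finset.all_card_le_biUnion_card_iff_exists_injective _).1 hall
  have himg : Finset.univ.image m = nb R := by
    refine Finset.eq_of_subset_of_card_le ?_ ?_
    · intro t ht
      obtain ⟨v, -, rfl⟩ := Finset.mem_image.1 ht
      have := Finset.mem_filter.1 (hm v)
      exact Finset.mem_filter.2 ⟨this.1, v, v.2, this.2⟩
    · rw [Finset.card_image_of_injective _ hminj, hReq]; simp
  have hinv : ∀ t ∈ nb R, ∃ v : R, m v = t := by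
    intro t ht
    rw [← himg] at ht
    simpa using ht
  obtain ⟨v0, hv0⟩ := hRne
  have hneR : Nonempty R := ⟨⟨v0, hv0⟩⟩
  let σ : B → R := Function.invFun m
  have hσ : ∀ t ∈ nb R, m (σ t) = t := fun t ht => Function.invFun_eq (hinv t ht)
  have hzero := ha.eq_zero (S := nb R) (σ := fun t => (σ t : A)) (η := η)
    (by
      intro t ht t' ht' h
      rw [← hσ t ht, ← hσ t' ht', Subtype.ext h])
    (by
      intro t ht
      have := (Finset.mem_filter.1 (hm (σ t))).2
      rwa [hσ t ht] at this)
    (by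
      intro i hi j hj
      by_cases h1 : η j = 0
      · simp [h1]
      · rw [ha.1 _ _ fun h2 => hj (Finset.mem_filter.2 ⟨by simpa [S] using h1, _, (σ i).2, h2⟩), zero_mul])
    (fun i hi => (Finset.mem_filter.1 (hRZ (σ i).2)).2.2)
  obtain ⟨t, ht⟩ := hnbne
  have : t ∈ S := (Finset.mem_filter.1 ht).1
  exact (Finset.mem_filter.1 this).2 (hzero t ht)

/-- The left side bounds the degree of the monomial with exponent `g` along `η`. The fibres over the
support of `η` provide the sum of `g t + 1` forms that involve the support, and fewer than the size
of the support among all such forms vanish at `η`. -/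
theorem IsGenericFor.sum_lt [Finite A] (ha : IsGenericFor adj a) {η : B → ℚ} (hη : η ≠ 0)
    {g : B → ℕ} (hg : IsPartialFiberCount adj fun t => g t + 1) :
    ∑ t with η t ≠ 0, g t < {v | ∑ t, a v t * η t ≠ 0}.ncard := by
  classical
  have := Fintype.ofFinite A
  obtain ⟨φ, hφ, hc⟩ := hg
  have h1 : ∑ t with η t ≠ 0, (g t + 1) ≤ {v | ∃ t, η t ≠ 0 ∧ adj v t}.ncard := by
    have : ∑ t with η t ≠ 0, (g t + 1) =
        ((Finset.univ.filter fun t => η t ≠ 0).biUnion fun t =>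
          Finset.univ.filter fun v => φ v = some t).card := by
      rw [Finset.card_biUnion]
      · refine Finset.sum_congr rfl fun t _ => ?_
        rw [← Set.ncard_coe_finset]; simpa using hc t
      · intro t _ t' _ htt'
        rw [Function.onFun, Finset.disjoint_left]
        intro v hv hv'
        simp only [Finset.mem_filter, Finset.mem_univ, true_and] at hv hv'
        rw [hv] at hv'
        exact htt' (Option.some.inj hv')
    rw [this, ← Set.ncard_coe_finset]
    refine Set.ncard_le_ncard ?_
    intro v hv
    obtain ⟨t, ht, hv⟩ : ∃ t, η t ≠ 0 ∧ φ v = some t := by simpa using hv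
    exact ⟨t, ht, hφ v t hv⟩
  have h2 : {v | ∃ t, η t ≠ 0 ∧ adj v t}.ncard ≤
      {v | (∃ t, η t ≠ 0 ∧ adj v t) ∧ ∑ t, a v t * η t = 0}.ncard +
        {v | ∑ t, a v t * η t ≠ 0}.ncard := by
    refine (Set.ncard_le_ncard ?_).trans (Set.ncard_union_le _ _)
    intro v hv
    by_cases h : ∑ t, a v t * η t = 0
    · exact Or.inl ⟨hv, h⟩
    · exact Or.inr h
  have h3 := ha.card_vanishing_lt hη
  have h4 : {t | η t ≠ 0}.ncard = (Finset.univ.filter fun t => η t ≠ 0).card := by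
    rw [← Set.ncard_coe_finset]; simp
  rw [Finset.sum_add_distrib, Finset.sum_const, smul_eq_mul, mul_one] at h1
  omega

end TransversalCount

/-! ### Interpolation at the vertices of a generic arrangement -/

section TransversalCount

variable {A B : Type*} [Fintype B] {adj : A → B → Prop} {a : A → B → ℚ}

/-- The linear form on `B → ℚ` with coefficients `b`. -/
def coeffForm (b : B → ℚ) : (B → ℚ) →ₗ[ℚ] ℚ := ∑ t, b t • LinearMap.proj t

@[simp]
theorem coeffForm_apply (b x : B → ℚ) : coeffForm b x = ∑ t, b t * x t := by
  simp [coeffForm, LinearMap.sum_apply]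

variable [DecidableEq B]

theorem IsGenericFor.eq_zero_of_saturates (ha : IsGenericFor adj a) {S : Set A}
    (hS : Saturates adj S) {η : B → ℚ} (hη : ∀ v ∈ S, coeffForm (a v) η = 0) : η = 0 := by
  obtain ⟨σ, hσ, hadj, rfl⟩ := hS
  ext t
  refine ha.eq_zero (S := Finset.univ) hσ.injOn (fun t _ => hadj t) (by simp) ?_ t
    (Finset.mem_univ t)
  intro i _
  simpa using hη (σ i) ⟨i, rfl⟩

theorem IsGenericFor.exists_vertex (ha : IsGenericFor adj a) (c : A → ℚ) {S : Set A}
    (hS : Saturates adj S) : ∃ x, ∀ v ∈ S, coeffForm (a v) x = c v := by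
  obtain ⟨σ, hσ, hadj, rfl⟩ := id hS
  have hinj : Function.Injective (LinearMap.pi fun t => coeffForm (a (σ t))) := by
    rw [injective_iff_map_eq_zero]
    intro η hη
    refine ha.eq_zero_of_saturates hS ?_
    rintro _ ⟨t, rfl⟩
    exact congr_fun hη t
  obtain ⟨x, hx⟩ := (LinearMap.injective_iff_surjective.1 hinj) fun t => c (σ t)
  refine ⟨x, ?_⟩
  rintro _ ⟨t, rfl⟩
  exact congr_fun hx t

/-- The forms of `S` are a basis of the dual space, so their matrix is square with nonzero
determinant. A nonzero term of the Leibniz expansion is a perfect matching. -/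
theorem IsGenericFor.saturates_of_vertex [Finite A] (ha : IsGenericFor adj a) {S : Set A}
    (hind : LinearIndepOn ℚ (fun v => coeffForm (a v)) S)
    (hker : ∀ η, (∀ v ∈ S, coeffForm (a v) η = 0) → η = 0) : Saturates adj S := by
  classical
  have := Fintype.ofFinite A
  have h1 : Fintype.card S ≤ Fintype.card B := by
    have := hind.fintype_card_le_finrank
    simpa [Subspace.dual_finrank_eq] using this
  have h2 : Fintype.card B ≤ Fintype.card S := by
    have hinj : Function.Injective (LinearMap.pi fun v : S => coeffForm (a v)) := by
      rw [injective_iff_map_eq_zero]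
      exact fun η hη => hker η fun v hv => congr_fun hη ⟨v, hv⟩
    simpa using LinearMap.finrank_le_finrank_of_injective hinj
  obtain ⟨e⟩ := Fintype.card_eq.1 (h2.antisymm h1)
  have hdet : (Matrix.of fun i j : B => a (e i) j).det ≠ 0 := by
    intro h
    obtain ⟨η, hη0, hη⟩ := Matrix.exists_mulVec_eq_zero_iff.2 h
    refine hη0 (hker η fun v hv => ?_)
    have := congr_fun hη (e.symm ⟨v, hv⟩)
    simpa [Matrix.mulVec, dotProduct] using this
  rw [Matrix.det_apply] at hdet
  obtain ⟨π, -, hπ⟩ := Finset.exists_ne_zero_of_sum_ne_zero hdet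
  have hπ' : ∀ t, a (e (π t)) t ≠ 0 := by
    intro t ht
    refine hπ ?_
    rw [Finset.prod_eq_zero (Finset.mem_univ t) (by simpa using ht), smul_zero]
  refine ⟨fun t => e (π t), fun t t' h => π.injective (e.injective (Subtype.ext h)), fun t => ?_, ?_⟩
  · by_contra h
    exact hπ' t (ha.1 _ _ h)
  · ext v
    constructor
    · rintro ⟨t, rfl⟩; exact (e (π t)).2
    · exact fun hv => ⟨π.symm (e.symm ⟨v, hv⟩), by simp⟩

/-- The exponents `g` for which `g + 1` counts the fibres of a partial function. -/
def trimmedCounts (adj : A → B → Prop) : Set (B →₀ ℕ) :=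
  {g | IsPartialFiberCount adj fun t => g t + 1}

theorem IsGenericFor.eq_zero_of_vanishes [Finite A] (ha : IsGenericFor adj a) {c : A → ℚ}
    (hc : ∀ x, LinearIndepOn ℚ (fun v => coeffForm (a v)) {v | coeffForm (a v) x = c v})
    {p : MvPolynomial B ℚ} (hp : p ∈ MvPolynomial.restrictSupport ℚ (trimmedCounts adj))
    (hv : ∀ x, Saturates adj {v | coeffForm (a v) x = c v} → MvPolynomial.eval x p = 0) :
    p = 0 := by
  classical
  have := Fintype.ofFinite A
  refine MvPolynomial.funext fun x => ?_
  rw [map_zero]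
  refine eq_zero_of_vanishes_at_vertices (fun v => coeffForm (a v)) c hc
    (fun x => MvPolynomial.eval x p) ?_ (fun x hx => hv x (ha.saturates_of_vertex (hc x) hx)) x
  intro x η hη
  refine ⟨MvPolynomial.eval₂ Polynomial.C (fun t => C (x t) + C (η t) * X) p, ?_, fun s => ?_⟩
  · rw [MvPolynomial.eval₂_eq', ← Polynomial.mem_degreeLT]
    refine Submodule.sum_mem _ fun g hg => ?_
    rw [← Polynomial.smul_eq_C_mul]
    refine Submodule.smul_mem _ _ ?_
    rw [Polynomial.mem_degreeLT]
    have hlt := ha.sum_lt hη (hp hg)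
    refine lt_of_le_of_lt ?_ (Nat.cast_lt.2 (by simpa using hlt))
    refine (Polynomial.degree_prod_le _ _).trans ?_
    rw [Finset.sum_filter, Nat.cast_sum]
    refine Finset.sum_le_sum fun t _ => ?_
    by_cases h : η t = 0
    · rw [if_neg (by simpa using h), h, C_0, zero_mul, add_zero, ← C_pow]
      exact Polynomial.degree_C_le
    · rw [if_pos h]
      refine (Polynomial.degree_pow_le _ _).trans ?_
      have : (C (x t) + C (η t) * X : ℚ[X]).degree ≤ 1 := by
        rw [add_comm]; exact Polynomial.degree_linear_le
      calc g t • (C (x t) + C (η t) * X : ℚ[X]).degree ≤ g t • (1 : WithBot ℕ) :=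
            nsmul_le_nsmul_right this _
        _ = _ := by simp
  · rw [← Polynomial.coe_evalRingHom, MvPolynomial.eval₂_comp_left, MvPolynomial.eval₂_eq',
      MvPolynomial.eval_eq']
    refine Finset.sum_congr rfl fun g _ => ?_
    simp only [RingHom.comp_apply, Function.comp_apply, coe_evalRingHom, eval_C, eval_add, eval_mul,
      eval_X, Pi.add_apply, Pi.smul_apply, smul_eq_mul, mul_comm s]

/-- The polynomial is the product of the affine forms of the elements outside `S`, up to sign of the
constants' convention. A term picks the constant or an adjacent coordinate for each such element;
the matching of `S` adds one to every fibre, so the exponent is a trimmed count. -/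
theorem exists_interpolating_polynomial [Finite A] (adj : A → B → Prop) (a : A → B → ℚ)
    (ha : ∀ v t, ¬ adj v t → a v t = 0) (c : A → ℚ) {S : Set A} (hS : Saturates adj S) :
    ∃ p ∈ MvPolynomial.restrictSupport ℚ (trimmedCounts adj),
      ∀ x, MvPolynomial.eval x p = 0 ↔ ∃ v ∉ S, coeffForm (a v) x = c v := by
  classical
  have := Fintype.ofFinite A
  obtain ⟨σ, hσ, hadj, rfl⟩ := hS
  -- `none` indexes the constant term; the factor of an element of `S` is 1.
  let b : A → Option B → ℚ := fun v o => if v ∈ Set.range σ then o.elim 1 0 else o.elim (- c v) (a v)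
  let Y : Option B → MvPolynomial B ℚ := fun o => o.elim 1 MvPolynomial.X
  refine ⟨∏ v, ∑ o, MvPolynomial.C (b v o) * Y o, ?_, fun x => ?_⟩
  · rw [Finset.prod_univ_sum]
    refine Submodule.sum_mem _ fun φ _ => ?_
    rw [Finset.prod_mul_distrib, ← map_prod, ← MvPolynomial.smul_eq_C_mul]
    by_cases h0 : ∏ v, b v (φ v) = 0
    · rw [h0, zero_smul]; exact Submodule.zero_mem _
    refine Submodule.smul_mem _ _ ?_
    have hb : ∀ v, b v (φ v) ≠ 0 := fun v => Finset.prod_ne_zero_iff.1 h0 v (Finset.mem_univ v)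
    have hnone : ∀ t, φ (σ t) = none := by
      intro t
      have := hb (σ t)
      cases h : φ (σ t) with
      | none => rfl
      | some t' => simp [b, h] at this
    have hφadj : ∀ v t, φ v = some t → adj v t := by
      intro v t h
      have := hb v
      by_contra hn
      apply this
      simp only [b, h, Option.elim_some, ha v t hn, Pi.zero_apply, ite_self]
    have hY : ∀ o, Y o = MvPolynomial.monomial (o.elim 0 fun t => Finsupp.single t 1) 1 := by
      rintro (_ | t) <;> simp [Y, MvPolynomial.X]
    simp_rw [hY]
    rw [← MvPolynomial.monomial_sum_one, MvPolynomial.monomial_mem_restrictSupport]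
    left
    refine ⟨fun v => if h : v ∈ Set.range σ then some h.choose else φ v, ?_, ?_⟩
    · intro v t h
      dsimp only at h
      split_ifs at h with hv
      · have := hv.choose_spec
        rw [Option.some.inj h] at this
        rw [← this]; exact hadj t
      · exact hφadj v t h
    · intro t
      have hset : {v | (if h : v ∈ Set.range σ then some h.choose else φ v) = some t} =
          insert (σ t) {v | φ v = some t} := by
        ext v
        simp only [Set.mem_ofPred_eq, Set.mem_insert_iff]
        by_cases hv : v ∈ Set.range σ
        · rw [dif_pos hv]
          have hcs := hv.choose_spec
          obtain ⟨t', rfl⟩ := hv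
          rw [hσ hcs, hnone, Option.some_inj]
          simp [hσ.eq_iff]
        · rw [dif_neg hv]
          have : v ≠ σ t := by rintro rfl; exact hv ⟨t, rfl⟩
          simp [this]
      rw [hset, Set.ncard_insert_of_notMem (by simp [hnone])]
      dsimp only
      congr 1
      rw [Finsupp.finsetSum_apply, Set.ncard_eq_toFinset_card', Finset.card_eq_sum_ones,
        Set.toFinset_ofPred, Finset.sum_filter]
      refine Finset.sum_congr rfl fun v _ => ?_
      cases h : φ v with
      | none => simp
      | some t' => simp [Finsupp.single_apply]
  · rw [map_prod, Finset.prod_eq_zero_iff]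
    refine exists_congr fun v => ?_
    by_cases hv : v ∈ Set.range σ
    · simp only [b, Y, if_pos hv]
      simp [hv]
    · simp only [b, Y, if_neg hv]
      simp only [Fintype.sum_option, Finset.mem_univ, true_and, hv, not_false_eq_true, map_add,
        map_mul, map_sum, MvPolynomial.eval_C, MvPolynomial.eval_X, Option.elim_none,
        Option.elim_some, mul_one, coeffForm_apply]
      rw [neg_add_eq_zero, eq_comm]

/-- The fibre counts, positive everywhere on `B`, of partial functions from `A` to `B` are
equinumerous with the subsets of `A` that are matched perfectly to `B`. -/
theorem card_partialFiberCount_eq_card_saturates [Finite A] (adj : A → B → Prop) :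
    {f : B → ℕ | (∀ t, f t ≠ 0) ∧ IsPartialFiberCount adj f}.ncard =
      {S : Set A | Saturates adj S}.ncard := by
  classical
  have := Fintype.ofFinite A
  obtain ⟨a, ha⟩ := exists_generic_coefficients adj
  obtain ⟨c, hc⟩ := exists_simple_arrangement fun v => coeffForm (a v)
  have hex := fun S : {S : Set A | Saturates adj S} => ha.exists_vertex c S.2
  choose θ hθ using hex
  -- At most `Fintype.card B` hyperplanes of a simple arrangement pass through a point, and `S`
  -- already supplies that many.
  have hθeq : ∀ S, {v | coeffForm (a v) (θ S) = c v} = S.1 := by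
    intro S
    have hsub : S.1 ⊆ {v | coeffForm (a v) (θ S) = c v} := fun v hv => hθ S v hv
    refine (Set.eq_of_subset_of_ncard_le hsub ?_).symm
    obtain ⟨σ, hσ, -, hr⟩ := S.2
    rw [← hr, ← Set.image_univ, Set.ncard_image_of_injective _ hσ, Set.ncard_univ,
      Nat.card_eq_fintype_card, ← Nat.card_coe_set_eq, Nat.card_eq_fintype_card]
    have := (hc (θ S)).fintype_card_le_finrank
    simpa [Subspace.dual_finrank_eq] using this
  let W := MvPolynomial.restrictSupport ℚ (trimmedCounts adj)
  let ev : W →ₗ[ℚ] ({S : Set A | Saturates adj S} → ℚ) :=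
    LinearMap.pi fun S => (MvPolynomial.aeval (θ S)).toLinearMap ∘ₗ W.subtype
  have hev : ∀ p S, ev p S = MvPolynomial.eval (θ S) p.1 := fun p S => by
    simp [ev]
  have hinj : Function.Injective ev := by
    rw [injective_iff_map_eq_zero]
    intro p hp
    refine Subtype.ext (ha.eq_zero_of_vanishes hc p.2 fun x hx => ?_)
    have : x = θ ⟨_, hx⟩ := by
      rw [← sub_eq_zero]
      refine ha.eq_zero_of_saturates hx fun v hv => ?_
      rw [map_sub, hθ ⟨_, hx⟩ v hv, sub_eq_zero]
      exact hv
    rw [this, ← hev, hp, Pi.zero_apply]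
  have hsurj : Function.Surjective ev := by
    have hQ := fun S : {S : Set A | Saturates adj S} =>
      exists_interpolating_polynomial adj a ha.1 c S.2
    choose Q hQW hQ using hQ
    -- The saturating sets have equal size, so `S'` has an element outside `S`, whose factor
    -- vanishes at `θ S'`.
    have h0 : ∀ S S', S' ≠ S → MvPolynomial.eval (θ S') (Q S) = 0 := by
      intro S S' hne
      rw [hQ]
      by_contra! h
      refine hne (Subtype.ext (Set.eq_of_subset_of_ncard_le (fun v hv => ?_) ?_))
      · by_contra hvS
        exact h v hvS (hθ S' v hv)
      · obtain ⟨σ, hσ, -, hr⟩ := S.2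
        obtain ⟨σ', hσ', -, hr'⟩ := S'.2
        rw [← hr, ← hr', ← Set.image_univ, ← Set.image_univ, Set.ncard_image_of_injective _ hσ,
          Set.ncard_image_of_injective _ hσ']
    have h1 : ∀ S, MvPolynomial.eval (θ S) (Q S) ≠ 0 := by
      intro S
      rw [Ne, hQ]
      rintro ⟨v, hv, h⟩
      rw [← hθeq S] at hv
      exact hv h
    intro y
    refine ⟨∑ S, (y S / MvPolynomial.eval (θ S) (Q S)) • ⟨Q S, hQW S⟩, funext fun S => ?_⟩
    rw [map_sum, Finset.sum_apply, Finset.sum_eq_single S]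
    · rw [map_smul, Pi.smul_apply, hev, smul_eq_mul, div_mul_cancel₀ _ (h1 S)]
    · intro S' _ hne
      rw [map_smul, Pi.smul_apply, hev, h0 _ _ hne.symm, smul_zero]
    · simp
  have hcard : (trimmedCounts adj).ncard = {S : Set A | Saturates adj S}.ncard := by
    have h := (LinearEquiv.ofBijective ev ⟨hinj, hsurj⟩).finrank_eq
    rw [Module.finrank_eq_nat_card_basis (MvPolynomial.basisRestrictSupport ℚ (trimmedCounts adj)),
      Module.finrank_fintype_fun_eq_card, Nat.card_coe_set_eq, ← Nat.card_eq_fintype_card,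
      Nat.card_coe_set_eq] at h
    exact h
  rw [← hcard]
  refine Set.ncard_congr (fun f _ => Finsupp.equivFunOnFinite.symm fun t => f t - 1) ?_ ?_ ?_
  · rintro f ⟨h1, h2⟩
    have : (fun t => f t - 1 + 1) = f := funext fun t => Nat.sub_add_cancel (Nat.pos_of_ne_zero (h1 t))
    simpa [trimmedCounts, this] using h2
  · intro f f' hf hf' h
    ext t
    have := DFunLike.congr_fun h t
    have h1 := hf.1 t
    have h2 := hf'.1 t
    simp only [Finsupp.equivFunOnFinite_symm_apply_apply] at this
    omega
  · intro g hg
    refine ⟨fun t => g t + 1, ⟨fun t => Nat.succ_ne_zero _, hg⟩, ?_⟩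
    ext t
    simp

end TransversalCount

/-! ### Base polytopes and independence of the order -/

section Polymatroid

/-- Transfer `k` from `b` to `a`. -/
def transfer {ε : Type*} [DecidableEq ε] (f : ε → ℤ) (a b : ε) (k : ℤ) : ε → ℤ := f + Pi.single a k - Pi.single b k

theorem sum_transfer {ε : Type*} [DecidableEq ε] (f : ε → ℤ) (a b : ε) (k : ℤ) (R : Finset ε) :
    ∑ e ∈ R, transfer f a b k e =
      ∑ e ∈ R, f e + (if a ∈ R then k else 0) - (if b ∈ R then k else 0) := by
  simp [transfer, Finset.sum_add_distrib, Finset.sum_sub_distrib]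

variable {ε : Type*} [Fintype ε] {c : Finset ε → ℤ} {f : ε → ℤ}

/-- The integer points of the base polytope of the set function `c`. -/
def basePoints (c : Finset ε → ℤ) : Set (ε → ℤ) :=
  {f | ∑ e, f e = c Finset.univ ∧ ∀ R, c R ≤ ∑ e ∈ R, f e}

/-- The inequality of the base polytope given by `R` is an equality at `f`. -/
def IsTight (c : Finset ε → ℤ) (f : ε → ℤ) (R : Finset ε) : Prop := ∑ e ∈ R, f e = c R

/-- Nothing can be transferred from `e` to any element of `D`. -/
def IsActive (c : Finset ε → ℤ) (f : ε → ℤ) (D : Finset ε) (e : ε) : Prop :=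
  ∃ R, IsTight c f R ∧ e ∈ R ∧ Disjoint R D

/-- The amount that can be transferred from `x` to `y`. -/
noncomputable def slack (c : Finset ε → ℤ) (f : ε → ℤ) (x y : ε) : ℤ :=
  sInf {k | ∃ R, x ∈ R ∧ y ∉ R ∧ ∑ e ∈ R, f e - c R = k}

/-- For `x ≠ y` the set contains the value at `R = {x}`; for `x = y` it is empty and `sInf` carries
no information. -/
theorem slack_isLeast {x y : ε} (hxy : x ≠ y) :
    IsLeast {k | ∃ R, x ∈ R ∧ y ∉ R ∧ ∑ e ∈ R, f e - c R = k} (slack c f x y) := by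
  have hfin : {k | ∃ R, x ∈ R ∧ y ∉ R ∧ ∑ e ∈ R, f e - c R = k}.Finite := by
    refine (Set.finite_range fun R => ∑ e ∈ R, f e - c R).subset ?_
    rintro k ⟨R, -, -, h⟩
    exact ⟨R, h⟩
  refine ⟨Int.csInf_mem ⟨_, {x}, by simp, by simpa using hxy.symm, rfl⟩ hfin.bddBelow,
    fun k hk => csInf_le hfin.bddBelow hk⟩

theorem slack_eq_iff {x y : ε} (hxy : x ≠ y) {k : ℤ} :
    slack c f x y = k ↔ IsLeast {k | ∃ R, x ∈ R ∧ y ∉ R ∧ ∑ e ∈ R, f e - c R = k} k :=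
  ⟨fun h => h ▸ slack_isLeast hxy, fun h => (slack_isLeast hxy).unique h⟩

theorem slack_nonneg (hf : f ∈ basePoints c) {x y : ε} (hxy : x ≠ y) : 0 ≤ slack c f x y := by
  obtain ⟨R, -, -, h⟩ := (slack_isLeast (f := f) (c := c) hxy).1
  have := hf.2 R
  omega

theorem slack_eq_zero_iff (hf : f ∈ basePoints c) {x y : ε} (hxy : x ≠ y) :
    slack c f x y = 0 ↔ ∃ R, IsTight c f R ∧ x ∈ R ∧ y ∉ R := by
  rw [slack_eq_iff hxy]
  constructor
  · rintro ⟨⟨R, h1, h2, h3⟩, -⟩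
    exact ⟨R, sub_eq_zero.1 h3, h1, h2⟩
  · rintro ⟨R, h1, h2, h3⟩
    refine ⟨⟨R, h2, h3, sub_eq_zero.2 h1⟩, ?_⟩
    rintro k ⟨R', -, -, rfl⟩
    exact sub_nonneg.2 (hf.2 R')

variable [DecidableEq ε]

/-- Supermodularity of a set function. -/
def IsSupermodular (c : Finset ε → ℤ) : Prop := ∀ R R', c R + c R' ≤ c (R ∪ R') + c (R ∩ R')

/-- Uncrossing: the excess of the sum of `f` over `c` is nonnegative and submodular in the set. -/
theorem isTight_union_inter (hc : IsSupermodular c) (hf : f ∈ basePoints c) {R R' : Finset ε}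
    (h : IsTight c f R) (h' : IsTight c f R') :
    IsTight c f (R ∪ R') ∧ IsTight c f (R ∩ R') := by
  have h1 := Finset.sum_union_inter (s₁ := R) (s₂ := R') (f := f)
  have h2 := hf.2 (R ∪ R')
  have h3 := hf.2 (R ∩ R')
  have h4 := hc R R'
  unfold IsTight at *
  constructor <;> linarith

/-- The reversal of the base points on each line of direction `a - b`. -/
noncomputable def reverseLine (c : Finset ε → ℤ) (a b : ε) (f : ε → ℤ) : ε → ℤ :=
  transfer f a b (slack c f b a - slack c f a b)

section ReverseLine

variable {a b : ε}

theorem sum_reverseLine_of_iff {R : Finset ε} (h : a ∈ R ↔ b ∈ R) :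
    ∑ e ∈ R, reverseLine c a b f e = ∑ e ∈ R, f e := by
  rw [reverseLine, sum_transfer]
  by_cases hb : b ∈ R
  · simp [hb, h.2 hb]
  · simp [hb, mt h.1 hb]

theorem isTight_reverseLine_iff {R : Finset ε} (h : a ∈ R ↔ b ∈ R) :
    IsTight c (reverseLine c a b f) R ↔ IsTight c f R := by
  rw [IsTight, IsTight, sum_reverseLine_of_iff h]

theorem reverseLine_mem (hab : a ≠ b) (hf : f ∈ basePoints c) : reverseLine c a b f ∈ basePoints c := by
  refine ⟨by rw [sum_reverseLine_of_iff (by simp)]; exact hf.1, fun R => ?_⟩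
  have h1 := slack_nonneg hf hab
  have h2 := slack_nonneg hf hab.symm
  have h3 := hf.2 R
  rw [reverseLine, sum_transfer]
  by_cases ha : a ∈ R <;> by_cases hb : b ∈ R <;> simp only [ha, hb, if_true, if_false]
  · linarith
  · have := (slack_isLeast (f := f) (c := c) hab).2 ⟨R, ha, hb, rfl⟩
    linarith
  · have := (slack_isLeast (f := f) (c := c) hab.symm).2 ⟨R, hb, ha, rfl⟩
    linarith
  · linarith

/-- All sets that contain `a` but not `b` have their excess shifted by the same amount, so the
minimum shifts by it too. -/
theorem slack_reverseLine_left (hab : a ≠ b) : slack c (reverseLine c a b f) a b = slack c f b a := by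
  rw [slack_eq_iff hab]
  obtain ⟨⟨R, ha, hb, h⟩, hle⟩ := slack_isLeast (f := f) (c := c) hab
  constructor
  · refine ⟨R, ha, hb, ?_⟩
    rw [reverseLine, sum_transfer, if_pos ha, if_neg hb]
    linarith
  · rintro k ⟨R', ha', hb', rfl⟩
    have := hle ⟨R', ha', hb', rfl⟩
    rw [reverseLine, sum_transfer, if_pos ha', if_neg hb']
    linarith

theorem slack_reverseLine_right (hab : a ≠ b) : slack c (reverseLine c a b f) b a = slack c f a b := by
  rw [slack_eq_iff hab.symm]
  obtain ⟨⟨R, hb, ha, h⟩, hle⟩ := slack_isLeast (f := f) (c := c) hab.symm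
  constructor
  · refine ⟨R, hb, ha, ?_⟩
    rw [reverseLine, sum_transfer, if_neg ha, if_pos hb]
    linarith
  · rintro k ⟨R', hb', ha', rfl⟩
    have := hle ⟨R', hb', ha', rfl⟩
    rw [reverseLine, sum_transfer, if_neg ha', if_pos hb']
    linarith

theorem reverseLine_reverseLine (hab : a ≠ b) : reverseLine c a b (reverseLine c a b f) = f := by
  conv_lhs => rw [reverseLine, slack_reverseLine_left hab, slack_reverseLine_right hab]
  ext e
  simp only [reverseLine, transfer, Pi.add_apply, Pi.sub_apply, Pi.single_apply]
  split_ifs <;> ring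

end ReverseLine

/-- Exchanging two consecutive elements `a` and `b`, both above `D`, does not change the generating
function of the inactive elements. -/
theorem sum_inactive_eq_of_swap (hc : IsSupermodular c) (F : Finset (ε → ℤ))
    (hF : ∀ f, f ∈ F ↔ f ∈ basePoints c) {a b : ε} (hab : a ≠ b) {D : Finset ε}
    {L L' : ε → Finset ε} (hLa : L a = D) (hLb : L b = insert a D)
    (hLa' : L' a = insert b D) (hLb' : L' b = D)
    (hL : ∀ e, e ≠ a → e ≠ b → L e = L' e ∧ ((a ∈ L e ∧ b ∈ L e) ∨ (e ∈ D ∧ L e ⊆ D))) :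
    ∑ f ∈ F, (X : ℤ[X]) ^ {e | ¬ IsActive c f (L e) e}.ncard =
      ∑ f ∈ F, X ^ {e | ¬ IsActive c f (L' e) e}.ncard := by
  classical
  -- The involution reverses a line only at points with such a tight set. The sum over a set
  -- containing both `a` and `b` is unchanged, so the condition is stable under the reversal.
  let Z : (ε → ℤ) → Prop := fun f => ∃ R, IsTight c f R ∧ a ∈ R ∧ b ∈ R ∧ Disjoint R D
  have hZ : ∀ f, Z (reverseLine c a b f) ↔ Z f := by
    intro f
    refine exists_congr fun R => ?_
    by_cases ha : a ∈ R
    · by_cases hb : b ∈ R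
      · rw [isTight_reverseLine_iff (by simp [ha, hb])]
      · simp [hb]
    · simp [ha]
  let τ : (ε → ℤ) → (ε → ℤ) := fun f => if Z f then reverseLine c a b f else f
  have hτF : ∀ f ∈ F, τ f ∈ F := by
    intro f hf
    simp only [τ]
    split_ifs
    · exact (hF _).2 (reverseLine_mem hab ((hF _).1 hf))
    · exact hf
  have hττ : ∀ f, τ (τ f) = f := by
    intro f
    by_cases h : Z f
    · simp [τ, h, (hZ f).2 h, reverseLine_reverseLine hab]
    · simp [τ, h]
  refine Finset.sum_nbij' τ τ hτF hτF (fun f _ => hττ f) (fun f _ => hττ f) fun f hfF => ?_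
  have hf := (hF f).1 hfF
  congr 1
  by_cases h : Z f
  · have hτ : τ f = reverseLine c a b f := by simp [τ, h]
    have hf' := reverseLine_mem hab hf (c := c)
    have hZ' := (hZ f).2 h
    rw [hτ]
    -- Intersecting with the tight set from `Z` gives disjointness from `D` for free, so each side
    -- says that a slack is zero; reversal exchanges the two slacks.
    have hends : IsActive c f (insert a D) b ↔ IsActive c (reverseLine c a b f) (insert b D) a := by
      have h1 : IsActive c f (insert a D) b ↔ slack c f b a = 0 := by
        rw [slack_eq_zero_iff hf hab.symm]
        constructor
        · rintro ⟨R, h1, h2, h3⟩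
          exact ⟨R, h1, h2, (Finset.disjoint_insert_right.1 h3).1⟩
        · rintro ⟨R, h1, h2, h3⟩
          obtain ⟨R', h4, h5, h6, h7⟩ := h
          refine ⟨R ∩ R', (isTight_union_inter hc hf h1 h4).2, by simp [h2, h6], ?_⟩
          rw [Finset.disjoint_insert_right]
          exact ⟨by simp [h3], h7.mono_left Finset.inter_subset_right⟩
      have h2 : IsActive c (reverseLine c a b f) (insert b D) a ↔ slack c (reverseLine c a b f) a b = 0 := by
        rw [slack_eq_zero_iff hf' hab]
        constructor
        · rintro ⟨R, h1, h2, h3⟩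
          exact ⟨R, h1, h2, (Finset.disjoint_insert_right.1 h3).1⟩
        · rintro ⟨R, h1, h2, h3⟩
          obtain ⟨R', h4, h5, h6, h7⟩ := hZ'
          refine ⟨R ∩ R', (isTight_union_inter hc hf' h1 h4).2, by simp [h2, h5], ?_⟩
          rw [Finset.disjoint_insert_right]
          exact ⟨by simp [h3], h7.mono_left Finset.inter_subset_right⟩
      rw [h1, h2, slack_reverseLine_left hab]
    have hAa : IsActive c f D a := by
      obtain ⟨R, h1, h2, h3, h4⟩ := h
      exact ⟨R, h1, h2, h4⟩
    have hAb : IsActive c (reverseLine c a b f) D b := by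
      obtain ⟨R, h1, h2, h3, h4⟩ := hZ'
      exact ⟨R, h1, h3, h4⟩
    have hrest : ∀ e, e ≠ a → e ≠ b →
        (IsActive c f (L e) e ↔ IsActive c (reverseLine c a b f) (L' e) e) := by
      intro e hea heb
      obtain ⟨h1, h2⟩ := hL e hea heb
      rw [← h1]
      rcases h2 with ⟨h2, h3⟩ | ⟨h2, h3⟩
      -- Above `a` and `b`: the relevant tight sets miss both, so their sums do not change.
      · refine exists_congr fun R => ?_
        by_cases hd : Disjoint R (L e)
        · have haR : a ∉ R := fun h => Finset.disjoint_left.1 hd h h2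
          have hbR : b ∉ R := fun h => Finset.disjoint_left.1 hd h h3
          rw [isTight_reverseLine_iff (by simp [haR, hbR])]
        · simp [hd]
      -- Below `a` and `b`: adjoin the tight set from `Z`, so that the union contains both and its
      -- sum does not change.
      · constructor
        · rintro ⟨R, h4, h5, h6⟩
          obtain ⟨R', h7, h8, h9, h10⟩ := h
          refine ⟨R ∪ R', (isTight_reverseLine_iff (by simp [h8, h9])).2
            (isTight_union_inter hc hf h4 h7).1, by simp [h5], ?_⟩
          rw [Finset.disjoint_union_left]
          exact ⟨h6, h10.mono_right h3⟩
        · rintro ⟨R, h4, h5, h6⟩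
          obtain ⟨R', h7, h8, h9, h10⟩ := hZ'
          refine ⟨R ∪ R', (isTight_reverseLine_iff (a := a) (b := b) (by simp [h8, h9])).1
            (isTight_union_inter hc hf' h4 h7).1, by simp [h5], ?_⟩
          rw [Finset.disjoint_union_left]
          exact ⟨h6, h10.mono_right h3⟩
    have himg : {e | ¬ IsActive c (reverseLine c a b f) (L' e) e} =
        Equiv.swap a b '' {e | ¬ IsActive c f (L e) e} := by
      ext e
      rw [Equiv.image_eq_preimage_symm, Equiv.symm_swap]
      simp only [Set.mem_ofPred_eq, Set.mem_preimage, not_iff_not]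
      by_cases hea : e = a
      · subst hea; rw [Equiv.swap_apply_left, hLa', hLb, hends]
      by_cases heb : e = b
      · subst heb; rw [Equiv.swap_apply_right, hLb', hLa]; exact iff_of_true hAb hAa
      rw [Equiv.swap_apply_of_ne_of_ne hea heb, hrest e hea heb]
    rw [himg, Set.ncard_image_of_injective _ (Equiv.injective _)]
  -- Without such a set, a tight set disjoint from `D` contains at most one of `a` and `b`, so
  -- adding the other to `D` has no effect.
  · have hτ : τ f = f := by simp [τ, h]
    rw [hτ]
    congr 1
    ext e
    simp only [Set.mem_ofPred_eq, not_iff_not]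
    by_cases hea : e = a
    · subst hea
      rw [hLa, hLa']
      refine exists_congr fun R => and_congr_right fun h1 => and_congr_right fun h2 => ?_
      rw [Finset.disjoint_insert_right]
      exact ⟨fun h3 => ⟨fun h4 => h ⟨R, h1, h2, h4, h3⟩, h3⟩, fun h3 => h3.2⟩
    by_cases heb : e = b
    · subst heb
      rw [hLb, hLb']
      refine exists_congr fun R => and_congr_right fun h1 => and_congr_right fun h2 => ?_
      rw [Finset.disjoint_insert_right]
      exact ⟨fun h3 => h3.2, fun h3 => ⟨fun h4 => h ⟨R, h1, h4, h2, h3⟩, h3⟩⟩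
    rw [(hL e hea heb).1]

/-- The generating function of the inactive elements may be computed with an order whose least
element is prescribed. -/
theorem exists_order_with_least (hc : IsSupermodular c) (F : Finset (ε → ℤ))
    (hF : ∀ f, f ∈ F ↔ f ∈ basePoints c) (r : ε) (ρ : ε → ℕ) (hρ : Function.Injective ρ) :
    ∃ ρ' : ε → ℕ, (∀ e, e ≠ r → ρ' r < ρ' e) ∧
      ∑ f ∈ F, (X : ℤ[X]) ^ {e | ¬ IsActive c f {e' | ρ e' < ρ e} e}.ncard =
        ∑ f ∈ F, X ^ {e | ¬ IsActive c f {e' | ρ' e' < ρ' e} e}.ncard := by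
  induction hn : (Finset.univ.filter fun e => ρ e < ρ r).card using Nat.strong_induction_on
    generalizing ρ with
  | _ n ih =>
  rcases (Finset.univ.filter fun e => ρ e < ρ r).eq_empty_or_nonempty with h0 | h0
  · refine ⟨ρ, fun e he => ?_, rfl⟩
    have : e ∉ Finset.univ.filter fun e => ρ e < ρ r := by simp [h0]
    have h1 : ¬ ρ e < ρ r := by simpa using this
    have h2 : ρ e ≠ ρ r := fun h => he (hρ h)
    omega
  -- `x` is the immediate predecessor of `r`; exchanging them leaves fewer elements below `r`.
  obtain ⟨x, hx, hmax⟩ := Finset.exists_max_image _ ρ h0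
  have hxr : ρ x < ρ r := by simpa using hx
  have hmax' : ∀ e, ρ e < ρ r → ρ e ≤ ρ x := fun e he => hmax e (by simpa using he)
  have hne : x ≠ r := by rintro rfl; exact lt_irrefl _ hxr
  let ρ' := ρ ∘ Equiv.swap x r
  have hρx : ρ' x = ρ r := by simp [ρ']
  have hρr : ρ' r = ρ x := by simp [ρ']
  have hρe : ∀ e, e ≠ x → e ≠ r → ρ' e = ρ e := fun e h1 h2 => by
    simp [ρ', Equiv.swap_apply_of_ne_of_ne h1 h2]
  have hinj : ∀ {e e'}, e ≠ e' → ρ e ≠ ρ e' := fun h h' => h (hρ h')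
  have hcases : ∀ e, e = x ∨ e = r ∨ (e ≠ x ∧ e ≠ r ∧ ρ' e = ρ e ∧ ρ e ≠ ρ x ∧ ρ e ≠ ρ r) := by
    intro e
    by_cases h1 : e = x
    · exact Or.inl h1
    by_cases h2 : e = r
    · exact Or.inr (Or.inl h2)
    exact Or.inr (Or.inr ⟨h1, h2, hρe e h1 h2, hinj h1, hinj h2⟩)
  have hDr : (Finset.univ.filter fun e => ρ' e < ρ' r) = Finset.univ.filter fun e => ρ e < ρ x := by
    ext e
    simp only [Finset.mem_filter, Finset.mem_univ, true_and]
    rcases hcases e with rfl | rfl | ⟨h1, h2, h3, h4, h5⟩ <;> omega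
  obtain ⟨ρ'', h1, h2⟩ := ih (Finset.univ.filter fun e => ρ' e < ρ' r).card (by
      rw [← hn, hDr]
      refine Finset.card_lt_card ⟨fun e he => ?_, fun h => ?_⟩
      · simp only [Finset.mem_filter, Finset.mem_univ, true_and] at he ⊢
        exact he.trans hxr
      · simpa using h hx) ρ' (hρ.comp (Equiv.injective _)) rfl
  refine ⟨ρ'', h1, Eq.trans ?_ h2⟩
  refine sum_inactive_eq_of_swap hc F hF (a := x) (b := r) hne
    (D := Finset.univ.filter fun e => ρ e < ρ x)
    (L := fun e => Finset.univ.filter fun e' => ρ e' < ρ e)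
    (L' := fun e => Finset.univ.filter fun e' => ρ' e' < ρ' e) rfl ?_ ?_ hDr ?_
  · ext e
    simp only [Finset.mem_filter, Finset.mem_univ, true_and, Finset.mem_insert]
    have := hmax' e
    rcases hcases e with rfl | rfl | ⟨h1, h2, h3, h4, h5⟩
    · simp [hxr]
    · simp [hne.symm]; omega
    · simp only [h1, false_or]; omega
  · ext e
    simp only [Finset.mem_filter, Finset.mem_univ, true_and, Finset.mem_insert]
    have := hmax' e
    rcases hcases e with rfl | rfl | ⟨h1, h2, h3, h4, h5⟩
    · simp [hne]
    · simp; omega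
    · simp only [h2, false_or]; omega
  · intro e he1 he2
    have h3 := hρe e he1 he2
    have h4 := hmax' e
    have h5 := hinj he1
    have h6 := hinj he2
    refine ⟨?_, ?_⟩
    · ext e'
      simp only [Finset.mem_filter, Finset.mem_univ, true_and]
      rcases hcases e' with rfl | rfl | ⟨h7, h8, h9, h10, h11⟩ <;> omega
    · by_cases h : ρ e < ρ x
      · right
        simp only [Finset.mem_filter, Finset.mem_univ, true_and]
        refine ⟨h, fun e' he' => ?_⟩
        simp only [Finset.mem_filter, Finset.mem_univ, true_and] at he' ⊢
        exact he'.trans h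
      · left
        simp only [Finset.mem_filter, Finset.mem_univ, true_and]
        omega

end Polymatroid

/-! ### Hypertrees as fibre counts of assignments -/

section Hypertrees

/-- In a tree with root `u`, each other vertex has exactly one neighbour that is nearer to the
root. -/
theorem SimpleGraph.IsTree.existsUnique_parent {W : Type*} {Γ : SimpleGraph W} (hΓ : Γ.IsTree)
    {u x : W} (hx : x ≠ u) : ∃! y, Γ.Adj x y ∧ Γ.dist u x = Γ.dist u y + 1 := by
  classical
  -- A neighbour nearer to the root is the penultimate vertex of a path from `u` to `x`, and a tree
  -- has only one such path.
  have ext_path : ∀ {y}, Γ.Adj x y → Γ.dist u x = Γ.dist u y + 1 →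
      ∃ p : Γ.Walk u x, p.IsPath ∧ p.penultimate = y := by
    intro y hy hd
    obtain ⟨p, hp, hlen⟩ := hΓ.connected.exists_path_of_dist u y
    refine ⟨p.concat hy.symm, ?_, by simp⟩
    apply SimpleGraph.Walk.isPath_of_length_eq_dist
    rw [SimpleGraph.Walk.length_concat, hlen, hd]
  obtain ⟨p, hp, hlen⟩ := hΓ.connected.exists_path_of_dist u x
  have hnil : ¬ p.Nil := fun h => hx h.eq.symm
  have hadj : Γ.Adj p.penultimate x := p.adj_penultimate hnil
  refine ⟨p.penultimate, ⟨hadj.symm, ?_⟩, ?_⟩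
  · have h1 : Γ.dist u p.penultimate ≤ p.dropLast.length := SimpleGraph.dist_le _
    have h2 : p.dropLast.length + 1 = p.length := SimpleGraph.Walk.length_dropLast_add_one hnil
    have h3 := hΓ.dist_eq_dist_add_one_of_adj u hadj
    omega
  · rintro y ⟨hy, hd⟩
    obtain ⟨q, hq, rfl⟩ := ext_path hy hd
    rw [(hΓ.existsUnique_path u x).unique hp hq]

namespace MultiHypergraph

variable {α ε : Type*} (H : MultiHypergraph α ε)

theorem bip_adj_iff {x y : α ⊕ ε} : H.bip.Adj x y ↔
    (∃ v e, v ∈ H.edge e ∧ x = Sum.inl v ∧ y = Sum.inr e) ∨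
      ∃ v e, v ∈ H.edge e ∧ x = Sum.inr e ∧ y = Sum.inl v := by
  simp only [bip, SimpleGraph.fromEdgeSet_adj, Set.mem_ofPred_eq, Sym2.eq_iff]
  grind

theorem bip_adj_inl_inr {v : α} {e : ε} : H.bip.Adj (Sum.inl v) (Sum.inr e) ↔ v ∈ H.edge e := by
  rw [bip_adj_iff]; simp

variable {H}

/-- Root the tree at `s` and let `φ` be the parent map on vertices. The neighbours of a hyperedge
are its parent and its children, which accounts for the `+ 1` in the degree. -/
theorem exists_assignment_of_mem_hypertrees [Finite α] [Finite ε] (s : α) {f : ε → ℕ}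
    (hf : f ∈ H.hypertrees) : ∃ φ : {v // v ≠ s} → ε,
      (∀ v, v.1 ∈ H.edge (φ v)) ∧ ∀ e, f e = {v | φ v = e}.ncard := by
  obtain ⟨Γ, hle, hΓ, hdeg⟩ := hf
  have hpar := fun x (hx : x ≠ Sum.inl s) => hΓ.existsUnique_parent hx
  choose! π hπ hπu using hpar
  have hφ : ∀ v : {v // v ≠ s}, ∃ e, π (Sum.inl v) = Sum.inr e ∧ v.1 ∈ H.edge e := by
    intro v
    have h := hle (hπ (Sum.inl v) (by simpa using v.2)).1
    rw [bip_adj_iff] at h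
    rcases h with ⟨w, e, h1, h2, h3⟩ | ⟨w, e, h1, h2, h3⟩
    · exact ⟨e, h3, by rwa [Sum.inl.inj h2]⟩
    · simp at h2
  choose φ hφ1 hφ2 using hφ
  refine ⟨φ, hφ2, fun e => ?_⟩
  have hset : Γ.neighborSet (Sum.inr e) =
      insert (π (Sum.inr e)) ((fun v : {v // v ≠ s} => (Sum.inl v.1 : α ⊕ ε)) '' {v | φ v = e}) := by
    ext y
    rw [SimpleGraph.mem_neighborSet, Set.mem_insert_iff]
    constructor
    · intro hy
      rcases hΓ.dist_eq_dist_add_one_of_adj (Sum.inl s) hy with h | h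
      · exact Or.inl (hπu _ (by simp) _ ⟨hy, h⟩)
      · right
        have hb := hle hy
        rw [bip_adj_iff] at hb
        rcases hb with ⟨v, e', h1, h2, h3⟩ | ⟨v, e', h1, h2, rfl⟩
        · simp at h2
        · have hvs : v ≠ s := by
            rintro rfl
            simp at h
          have := hπu (Sum.inl v) (by simpa using hvs) _ ⟨hy.symm, h⟩
          refine ⟨⟨v, hvs⟩, ?_, rfl⟩
          have h4 := hφ1 ⟨v, hvs⟩
          rw [← this] at h4
          exact (Sum.inr.inj h4).symm
    · rintro (rfl | ⟨v, rfl, rfl⟩)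
      · exact (hπ _ (by simp)).1
      · have := (hπ (Sum.inl v) (by simpa using v.2)).1
        rw [hφ1] at this
        exact this.symm
  have hnot : π (Sum.inr e) ∉
      ((fun v : {v // v ≠ s} => (Sum.inl v.1 : α ⊕ ε)) '' {v | φ v = e}) := by
    rintro ⟨v, rfl, hv⟩
    have h1 := (hπ (Sum.inr (φ v)) (by simp)).2
    have h2 := (hπ (Sum.inl v) (by simpa using v.2)).2
    rw [hφ1] at h2
    dsimp only at hv
    rw [← hv] at h1
    omega
  have h := hdeg e
  rw [hset, Set.ncard_insert_of_notMem hnot, Set.ncard_image_of_injective] at h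
  · omega
  · intro v w h
    exact Subtype.ext (Sum.inl.inj h)

/-- Join `s` to all hyperedges and each other vertex `v` to `φ v`. This graph is connected and has
one edge fewer than vertices. -/
theorem mem_hypertrees_of_assignment [Finite α] [Finite ε] {s : α} (hs : ∀ e, s ∈ H.edge e)
    (φ : {v // v ≠ s} → ε) (hφ : ∀ v, v.1 ∈ H.edge (φ v)) :
    (fun e => {v | φ v = e}.ncard) ∈ H.hypertrees := by
  classical
  let g : ε ⊕ {v // v ≠ s} → Sym2 (α ⊕ ε) :=
    Sum.elim (fun e => s(Sum.inl s, Sum.inr e)) (fun v => s(Sum.inl v.1, Sum.inr (φ v)))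
  let Γ : SimpleGraph (α ⊕ ε) := SimpleGraph.fromEdgeSet (Set.range g)
  have hadj1 : ∀ e, Γ.Adj (Sum.inl s) (Sum.inr e) := fun e =>
    (SimpleGraph.fromEdgeSet_adj _).2 ⟨⟨Sum.inl e, rfl⟩, by simp⟩
  have hadj2 : ∀ v : {v // v ≠ s}, Γ.Adj (Sum.inl v.1) (Sum.inr (φ v)) := fun v =>
    (SimpleGraph.fromEdgeSet_adj _).2 ⟨⟨Sum.inr v, rfl⟩, by simp⟩
  have hginj : Function.Injective g := by
    rintro (e | v) (e' | v') h
    · simpa [g] using h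
    · simp [g] at h; exact absurd h.1.symm v'.2
    · simp [g] at h; exact absurd h.1 v.2
    · simp [g] at h; rw [Subtype.ext h.1]
  have hedge : Γ.edgeSet = Set.range g := by
    rw [SimpleGraph.edgeSet_fromEdgeSet, sdiff_eq_left, Set.disjoint_left]
    rintro _ ⟨e | v, rfl⟩ <;> simp [g]
  have hle : Γ ≤ H.bip := by
    apply SimpleGraph.fromEdgeSet_mono
    rintro _ ⟨e | v, rfl⟩
    · exact ⟨s, e, hs e, rfl⟩
    · exact ⟨v, φ v, hφ v, rfl⟩
  refine ⟨Γ, hle, ?_, fun e => ?_⟩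
  · rw [SimpleGraph.isTree_iff_connected_and_card]
    constructor
    · have hr : ∀ x, Γ.Reachable (Sum.inl s) x := by
        rintro (v | e)
        · by_cases hv : v = s
          · rw [hv]
          · exact (hadj1 (φ ⟨v, hv⟩)).reachable.trans (hadj2 ⟨v, hv⟩).symm.reachable
        · exact (hadj1 e).reachable
      exact { preconnected := fun x y => (hr x).symm.trans (hr y), nonempty := ⟨Sum.inl s⟩ }
    · rw [hedge, ← Nat.card_congr (Equiv.ofInjective g hginj), Nat.card_sum, Nat.card_sum]
      have := Fintype.ofFinite α
      have h1 : Nat.card {v // v ≠ s} + 1 = Nat.card α := by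
        rw [Nat.card_eq_fintype_card, Nat.card_eq_fintype_card, Fintype.card_subtype_compl,
          Fintype.card_subtype_eq]
        have : 0 < Fintype.card α := Fintype.card_pos_iff.2 ⟨s⟩
        omega
      omega
  · have hset : Γ.neighborSet (Sum.inr e) =
        insert (Sum.inl s) ((fun v : {v // v ≠ s} => (Sum.inl v.1 : α ⊕ ε)) '' {v | φ v = e}) := by
      ext y
      rw [SimpleGraph.mem_neighborSet, Set.mem_insert_iff]
      constructor
      · intro h
        obtain ⟨⟨e' | v, h⟩, -⟩ := (SimpleGraph.fromEdgeSet_adj _).1 h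
        · left
          have : Sum.inl s = y ∧ e' = e := by simpa [g, Sym2.eq_iff] using h
          exact this.1.symm
        · right
          have : Sum.inl v.1 = y ∧ φ v = e := by simpa [g, Sym2.eq_iff] using h
          exact ⟨v, this.2, this.1⟩
      · rintro (rfl | ⟨v, rfl, rfl⟩)
        · exact (hadj1 e).symm
        · exact (hadj2 v).symm
    rw [hset, Set.ncard_insert_of_notMem, Set.ncard_image_of_injective]
    · intro v w h
      exact Subtype.ext (Sum.inl.inj h)
    · rintro ⟨v, -, h⟩
      exact v.2 (Sum.inl.inj h)

theorem mem_hypertrees_iff [Finite α] [Finite ε] {s : α} (hs : ∀ e, s ∈ H.edge e) {f : ε → ℕ} :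
    f ∈ H.hypertrees ↔ ∃ φ : {v // v ≠ s} → ε,
      (∀ v, v.1 ∈ H.edge (φ v)) ∧ ∀ e, f e = {v | φ v = e}.ncard := by
  refine ⟨exists_assignment_of_mem_hypertrees s, ?_⟩
  rintro ⟨φ, hφ, hf⟩
  rw [funext hf]
  exact mem_hypertrees_of_assignment hs φ hφ

end MultiHypergraph

end Hypertrees

/-! ### Fibre counts as base points -/

section Assignments

variable {A ε : Type*}

/-- `f` counts the fibres of a function from `A` to `ε` along the relation `N`. -/
def IsFiberCount (N : A → ε → Prop) (f : ε → ℕ) : Prop :=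
  ∃ φ : A → ε, (∀ v, N v (φ v)) ∧ ∀ e, f e = {v | φ v = e}.ncard

/-- The number of elements of `A` that are related to elements of `R` only. -/
noncomputable def confinedCard (N : A → ε → Prop) (R : Finset ε) : ℤ :=
  ({v | ∀ e, N v e → e ∈ R} : Set A).ncard

theorem confinedCard_nonneg (N : A → ε → Prop) (R : Finset ε) : 0 ≤ confinedCard N R :=
  Nat.cast_nonneg _

theorem confinedCard_isSupermodular [Finite A] [DecidableEq ε] (N : A → ε → Prop) :
    IsSupermodular (confinedCard N) := by
  intro R R'
  have h1 := Set.ncard_union_add_ncard_inter {v | ∀ e, N v e → e ∈ R} {v | ∀ e, N v e → e ∈ R'}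
  have h2 : ({v | ∀ e, N v e → e ∈ R} ∪ {v | ∀ e, N v e → e ∈ R'} : Set A).ncard ≤
      ({v | ∀ e, N v e → e ∈ R ∪ R'} : Set A).ncard := by
    refine Set.ncard_le_ncard ?_
    rintro v (hv | hv) e he
    · exact Finset.mem_union_left _ (hv e he)
    · exact Finset.mem_union_right _ (hv e he)
  have h3 : ({v | ∀ e, N v e → e ∈ R} ∩ {v | ∀ e, N v e → e ∈ R'} : Set A) =
      {v | ∀ e, N v e → e ∈ R ∩ R'} := by
    ext v
    simp only [Set.mem_inter_iff, Set.mem_ofPred_eq, Finset.mem_inter]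
    exact ⟨fun h e he => ⟨h.1 e he, h.2 e he⟩, fun h => ⟨fun e he => (h e he).1, fun e he => (h e he).2⟩⟩
  rw [h3] at h1
  unfold confinedCard
  omega

theorem sum_ncard_fiber [Finite A] (φ : A → ε) (R : Finset ε) :
    ∑ e ∈ R, {v | φ v = e}.ncard = {v | φ v ∈ R}.ncard := by
  classical
  have := Fintype.ofFinite A
  have h := Finset.card_eq_sum_card_fiberwise (f := φ) (s := {v | φ v ∈ R}) (t := R)
    (fun v hv => by simpa using hv)
  rw [Set.ncard_eq_toFinset_card', Set.toFinset_ofPred, h]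
  refine Finset.sum_congr rfl fun e he => ?_
  rw [Set.ncard_eq_toFinset_card', Set.toFinset_ofPred, Finset.filter_filter]
  congr 1
  ext v
  simp only [Finset.mem_filter, Finset.mem_univ, true_and]
  exact ⟨fun h => ⟨h ▸ he, h⟩, fun h => h.2⟩

/-- The converse is Hall's theorem with `f e` copies of each `e`: a set `s` is confined to its
neighbourhood `R`, so its size is at most `confinedCard N R`. Equality of the totals makes the
matching bijective, so each fibre has exactly `f e` elements. -/
theorem isFiberCount_iff_mem_basePoints [Finite A] [Fintype ε] (N : A → ε → Prop) (f : ε → ℕ) :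
    IsFiberCount N f ↔ (fun e => (f e : ℤ)) ∈ basePoints (confinedCard N) := by
  classical
  have := Fintype.ofFinite A
  have huniv : confinedCard N Finset.univ = Fintype.card A := by
    simp [confinedCard, Set.ncard_univ]
  constructor
  · rintro ⟨φ, hφ, hf⟩
    have hsum : ∀ R : Finset ε, ∑ e ∈ R, (f e : ℤ) = {v | φ v ∈ R}.ncard := fun R => by
      rw [← sum_ncard_fiber, Nat.cast_sum]
      simp only [hf]
    refine ⟨by rw [hsum, huniv]; simp [Set.ncard_univ], fun R => ?_⟩
    rw [hsum, confinedCard, Nat.cast_le]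
    exact Set.ncard_le_ncard fun v hv => hv _ (hφ v)
  · rintro ⟨h1, h2⟩
    let t : A → Finset (Σ e, Fin (f e)) := fun v => Finset.univ.filter fun p => N v p.1
    have hall : ∀ s : Finset A, s.card ≤ (s.biUnion t).card := by
      intro s
      let R : Finset ε := Finset.univ.filter fun e => ∃ v ∈ s, N v e
      have hb : s.biUnion t = R.sigma fun e => (Finset.univ : Finset (Fin (f e))) := by
        ext p
        simp [t, R]
      have h3 := h2 R
      have h4 : s.card ≤ ({v | ∀ e, N v e → e ∈ R} : Set A).ncard := by
        rw [← Set.ncard_coe_finset]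
        refine Set.ncard_le_ncard fun v hv e he => ?_
        simp only [R, Finset.mem_filter, Finset.mem_univ, true_and]
        exact ⟨v, hv, he⟩
      rw [hb, Finset.card_sigma]
      simp only [Finset.card_univ, Fintype.card_fin]
      unfold confinedCard at h3
      have h5 := Int.ofNat_le.2 h4
      have h6 : ((s.card : ℕ) : ℤ) ≤ ((∑ e ∈ R, f e : ℕ) : ℤ) := by
        rw [Nat.cast_sum]; exact h5.trans h3
      exact_mod_cast h6
    obtain ⟨m, hm, hmN⟩ := (Finset.all_card_le_biUnion_card_iff_exists_injective t).1 hall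
    have hcard : Fintype.card A = Fintype.card (Σ e, Fin (f e)) := by
      have h3 : ∑ e, (f e : ℤ) = Fintype.card A := h1.trans huniv
      rw [Fintype.card_sigma]
      simp only [Fintype.card_fin]
      exact_mod_cast h3.symm
    have hbij : Function.Bijective m := (Fintype.bijective_iff_injective_and_card m).2 ⟨hm, hcard⟩
    refine ⟨fun v => (m v).1, fun v => (Finset.mem_filter.1 (hmN v)).2, fun e => ?_⟩
    have himg : m '' {v | (m v).1 = e} = Set.range (Sigma.mk e) := by
      ext ⟨e', i⟩
      constructor
      · rintro ⟨v, hv, h⟩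
        have : e' = e := by rw [← hv, h]
        subst this
        exact ⟨i, rfl⟩
      · rintro ⟨j, hj⟩
        obtain ⟨v, hv⟩ := hbij.2 ⟨e', i⟩
        refine ⟨v, ?_, hv⟩
        have := congr_arg Sigma.fst hj
        simp only [Set.mem_ofPred_eq, hv]
        exact this.symm
    rw [← Set.ncard_image_of_injective _ hm, himg, ← Set.image_univ,
      Set.ncard_image_of_injective _ sigma_mk_injective, Set.ncard_univ]
    simp

end Assignments

/-! ### Activity in terms of unit transfers -/

section Activity

variable {ε : Type*} [Fintype ε] [DecidableEq ε] {c : Finset ε → ℤ} {f : ε → ℤ}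

/-- Tight sets are closed under intersection, so sets missing the elements of `D` one at a time
combine into one missing all of `D`. -/
theorem isActive_iff (hc : IsSupermodular c) (hf : f ∈ basePoints c) {D : Finset ε} {e : ε} :
    IsActive c f D e ↔ ∀ d ∈ D, ∃ R, IsTight c f R ∧ e ∈ R ∧ d ∉ R := by
  constructor
  · rintro ⟨R, h1, h2, h3⟩ d hd
    exact ⟨R, h1, h2, Finset.disjoint_right.1 h3 hd⟩
  · intro h
    induction D using Finset.induction_on with
    | empty => exact ⟨Finset.univ, hf.1, Finset.mem_univ _, Finset.disjoint_empty_right _⟩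
    | insert d D _ ih =>
      obtain ⟨R, h1, h2, h3⟩ := ih fun d hd => h d (Finset.mem_insert_of_mem hd)
      obtain ⟨R', h4, h5, h6⟩ := h d (Finset.mem_insert_self d D)
      refine ⟨R ∩ R', (isTight_union_inter hc hf h1 h4).2, Finset.mem_inter.2 ⟨h2, h5⟩, ?_⟩
      rw [Finset.disjoint_insert_right]
      exact ⟨fun h => h6 (Finset.mem_inter.1 h).2, h3.mono_left Finset.inter_subset_left⟩

theorem transfer_mem_basePoints_iff (hf : f ∈ basePoints c) {a b : ε} :
    transfer f a b 1 ∈ basePoints c ↔ ¬ ∃ R, IsTight c f R ∧ b ∈ R ∧ a ∉ R := by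
  constructor
  · rintro ⟨-, h⟩ ⟨R, h1, h2, h3⟩
    have := h R
    rw [sum_transfer, if_neg h3, if_pos h2, h1] at this
    omega
  · intro h
    refine ⟨by rw [sum_transfer]; simpa using hf.1, fun R => ?_⟩
    rw [sum_transfer]
    have h1 := hf.2 R
    by_cases ha : a ∈ R
    · rw [if_pos ha]
      split_ifs <;> omega
    by_cases hb : b ∈ R
    · rw [if_neg ha, if_pos hb]
      have : ¬ IsTight c f R := fun h' => h ⟨R, h', hb, ha⟩
      unfold IsTight at this
      omega
    · simpa [ha, hb] using h1

end Activity

namespace MultiHypergraph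

variable {α ε : Type*} {H : MultiHypergraph α ε}

/-- If a vertex `s` lies in all hyperedges and a hyperedge `r` contains all vertices, then the
interior polynomial counts the hypertrees by the size of their support outside `r`. -/
theorem interiorPolynomial_eq_sum_support [Finite α] [Finite ε] [LinearOrder ε] {s : α}
    (hs : ∀ e, s ∈ H.edge e) {r : ε} (hr : ∀ v, v ∈ H.edge r) :
    H.interiorPolynomial =
      ∑ f ∈ H.hypertrees_finite.toFinset, X ^ {e | e ≠ r ∧ f e ≠ 0}.ncard := by
  have := Fintype.ofFinite ε
  let N : {v // v ≠ s} → ε → Prop := fun v e => v.1 ∈ H.edge e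
  have hmem : ∀ f, f ∈ H.hypertrees ↔ (fun e => (f e : ℤ)) ∈ basePoints (confinedCard N) :=
    fun f => (mem_hypertrees_iff hs).trans (isFiberCount_iff_mem_basePoints N f)
  have hc := confinedCard_isSupermodular N
  have hcast : Function.Injective fun (f : ε → ℕ) e => (f e : ℤ) := fun f g h =>
    funext fun e => Nat.cast_injective (congr_fun h e)
  have hlift : ∀ g ∈ basePoints (confinedCard N), ∃ f : ε → ℕ, (fun e => (f e : ℤ)) = g := by
    intro g hg
    refine ⟨fun e => (g e).toNat, funext fun e => Int.toNat_of_nonneg ?_⟩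
    simpa using (confinedCard_nonneg N {e}).trans (hg.2 {e})
  let F := H.hypertrees_finite.toFinset.image fun f e => (f e : ℤ)
  have hF : ∀ g, g ∈ F ↔ g ∈ basePoints (confinedCard N) := by
    intro g
    simp only [F, Finset.mem_image, Set.Finite.mem_toFinset]
    constructor
    · rintro ⟨f, hf, rfl⟩; exact (hmem f).1 hf
    · intro hg
      obtain ⟨f, rfl⟩ := hlift g hg
      exact ⟨f, (hmem f).2 hg, rfl⟩
  let ρ : ε → ℕ := fun e => (Finset.univ.filter fun e' => e' < e).card
  have hρ : StrictMono ρ := by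
    intro e e' h
    refine Finset.card_lt_card ⟨fun x hx => ?_, fun hsub => ?_⟩
    · simp only [Finset.mem_filter, Finset.mem_univ, true_and] at hx ⊢
      exact hx.trans h
    · have := hsub (Finset.mem_filter.2 ⟨Finset.mem_univ _, h⟩)
      simp at this
  obtain ⟨ρ', hρ', heq⟩ := exists_order_with_least hc F hF r ρ hρ.injective
  rw [Finset.sum_image hcast.injOn, Finset.sum_image hcast.injOn] at heq
  have hL : H.interiorPolynomial = ∑ f ∈ H.hypertrees_finite.toFinset, (X : ℤ[X]) ^
      {e | ¬ IsActive (confinedCard N) (fun e => (f e : ℤ)) {e' | ρ e' < ρ e} e}.ncard := by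
    refine Finset.sum_congr rfl fun f hf => ?_
    rw [Set.Finite.mem_toFinset] at hf
    have hfb := (hmem f).1 hf
    congr 2
    ext e
    simp only [Set.mem_ofPred_eq]
    rw [isActive_iff hc hfb]
    push Not
    refine exists_congr fun e' => ?_
    simp only [Finset.mem_filter, Finset.mem_univ, true_and, hρ.lt_iff_lt]
    refine and_congr_right fun hlt => ?_
    have htr := transfer_mem_basePoints_iff hfb (a := e') (b := e)
    push Not at htr
    rw [← htr]
    constructor
    · rintro ⟨g, hg, h1, h2, h3⟩
      have : (fun e => (g e : ℤ)) = transfer (fun e => (f e : ℤ)) e' e 1 := by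
        ext x
        simp only [transfer, Pi.add_apply, Pi.sub_apply, Pi.single_apply]
        by_cases hx : x = e
        · subst hx
          simp [hlt.ne']; omega
        by_cases hx' : x = e'
        · subst hx'
          simp [hx, h2]
        · simp [hx, hx', h3 x hx hx']
      rw [← this]
      exact (hmem g).1 hg
    · intro hg
      obtain ⟨g, hg'⟩ := hlift _ hg
      rw [← hg'] at hg
      have hv : ∀ x, (g x : ℤ) = f x + (if x = e' then 1 else 0) - if x = e then 1 else 0 := by
        intro x
        have := congr_fun hg' x
        simpa [transfer, Pi.single_apply] using this
      refine ⟨g, (hmem g).2 hg, ?_, ?_, fun x hx hx' => ?_⟩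
      · have := hv e; simp [hlt.ne'] at this; omega
      · have := hv e'; simp [hlt.ne] at this; omega
      · have := hv x; simp [hx, hx'] at this; omega
  rw [hL]
  refine heq.trans (Finset.sum_congr rfl fun f hf => ?_)
  rw [Set.Finite.mem_toFinset] at hf
  have hfb := (hmem f).1 hf
  congr 2
  ext e
  simp only [Set.mem_ofPred_eq]
  rw [isActive_iff hc hfb]
  constructor
  -- Nothing lies below `r`, so `r` is active. If `f e = 0`, then `{e}` is tight because
  -- `confinedCard` is nonnegative, so `e` is active.
  · intro h
    refine ⟨?_, fun h0 => h fun d hd => ⟨{e}, ?_, by simp, ?_⟩⟩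
    · rintro rfl
      refine h fun d hd => ?_
      simp only [Finset.mem_filter, Finset.mem_univ, true_and] at hd
      have hde : d ≠ e := by rintro rfl; exact lt_irrefl _ hd
      exact absurd (hρ' d hde) (by omega)
    · have h1 := hfb.2 {e}
      have h2 := confinedCard_nonneg N {e}
      simp only [Finset.sum_singleton, h0] at h1
      simp only [IsTight, Finset.sum_singleton, h0]
      omega
    · simp only [Finset.mem_filter, Finset.mem_univ, true_and] at hd
      rw [Finset.mem_singleton]
      rintro rfl
      exact lt_irrefl _ hd
  · rintro ⟨her, h0⟩ h
    obtain ⟨R, h1, h2, h3⟩ := h r (by simpa using hρ' e her)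
    -- Every vertex lies in `r`, so none is confined to a set without `r`; tightness then forces `f`
    -- to vanish on `R`.
    have hzero : confinedCard N R = 0 := by
      have : ({v | ∀ e, N v e → e ∈ R} : Set {v // v ≠ s}) = ∅ :=
        Set.eq_empty_of_forall_notMem fun v hv => h3 (hv r (hr v.1))
      simp [confinedCard, this]
    rw [IsTight, hzero, Finset.sum_eq_zero_iff_of_nonneg fun _ _ => Nat.cast_nonneg _] at h1
    exact h0 (by exact_mod_cast h1 e h2)

end MultiHypergraph

/-! ### Vertex sets of matchings -/

section Matchings

variable {V A E : Type*} {G : SimpleGraph V} {V₁ V₂ : Set V}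

theorem SimpleGraph.Subgraph.IsMatching.ncard_edgeSet_eq {M : G.Subgraph} (hM : M.IsMatching)
    (hG : G.IsBipartiteWith V₁ V₂) : M.edgeSet.ncard = (M.verts ∩ V₂).ncard := by
  symm
  have hdis := Set.disjoint_left.1 hG.disjoint
  have hpar : ∀ x, x ∈ M.verts → ∃ y, M.Adj x y := fun x hx => (hM hx).exists
  choose! m hm using hpar
  refine Set.ncard_congr (fun x _ => s(x, m x)) (fun x hx => ?_) (fun x y hx hy h => ?_) ?_
  · exact hm x hx.1
  · have h1 := hG.mem_of_adj (hm y hy.1).adj_sub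
    rcases Sym2.eq_iff.1 h with h | h
    · exact h.1
    · rcases h1 with ⟨h1, h2⟩ | ⟨h1, h2⟩
      · exact absurd hy.2 (hdis h1)
      · exact absurd (h.1 ▸ hx.2) (hdis h2)
  · rintro ⟨x, y⟩ hxy
    have hxy : M.Adj x y := hxy
    rcases hG.mem_of_adj hxy.adj_sub with ⟨h1, h2⟩ | ⟨h1, h2⟩
    · refine ⟨y, ⟨hxy.snd_mem, h2⟩, ?_⟩
      rw [hM.eq_of_adj_left (hm y hxy.snd_mem) hxy.symm]
      exact Sym2.eq_swap
    · refine ⟨x, ⟨hxy.fst_mem, h1⟩, ?_⟩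
      rw [hM.eq_of_adj_left (hm x hxy.fst_mem) hxy]

/-- A vertex set of a matching is determined by its traces on the two parts, and the existence of
the matching says that one trace saturates the other; its size is the number of edges, each having
one end in `V₂`. -/
theorem ncard_matchingVertexSets (hG : G.IsBipartiteWith V₁ V₂) {N : A → E → Prop} {a : A → V}
    {b : E → V} (ha : Function.Injective a) (hb : Function.Injective b) (har : Set.range a = V₁)
    (hbr : Set.range b = V₂) (hN : ∀ v e, N v e ↔ G.Adj (a v) (b e)) (k : ℕ) :
    (matchingVertexSets G k).ncard =
      {p : Set E × Set A | p.1.ncard = k ∧ Saturates (fun v (e : p.1) => N v e) p.2}.ncard := by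
  have hmA : ∀ v, a v ∈ V₁ := fun v => har ▸ Set.mem_range_self v
  have hmB : ∀ e, b e ∈ V₂ := fun e => hbr ▸ Set.mem_range_self e
  have hdis : ∀ v e, a v ≠ b e := fun v e h =>
    Set.disjoint_left.1 hG.disjoint (hmA v) (h ▸ hmB e)
  have haS : ∀ (T : Set E) (S : Set A), a ⁻¹' (a '' S ∪ b '' T) = S := by
    intro T S
    ext v
    constructor
    · rintro (⟨w, hw, h⟩ | ⟨e, -, h⟩)
      · rwa [← ha h]
      · exact absurd h.symm (hdis v e)
    · exact fun hv => Or.inl ⟨v, hv, rfl⟩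
  have hbT : ∀ (T : Set E) (S : Set A), b ⁻¹' (a '' S ∪ b '' T) = T := by
    intro T S
    ext e
    constructor
    · rintro (⟨w, -, h⟩ | ⟨e', he, h⟩)
      · exact absurd h (hdis w e)
      · rwa [← hb h]
    · exact fun hv => Or.inr ⟨e, hv, rfl⟩
  have hV2 : ∀ W : Set V, (b ⁻¹' W).ncard = (W ∩ V₂).ncard := by
    intro W
    rw [← Set.ncard_image_of_injective _ hb, Set.image_preimage_eq_inter_range, hbr]
  symm
  refine Set.ncard_congr (fun p _ => a '' p.2 ∪ b '' p.1) ?_ ?_ ?_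
  · rintro ⟨T, S⟩ ⟨hT, σ, hσ, hadj, hr⟩
    dsimp only at hT hr ⊢
    let e1 : T ≃ b '' T := Equiv.Set.image b T hb
    let e2 : T ≃ S := (Equiv.ofInjective σ hσ).trans (Equiv.setCongr hr)
    let e3 : S ≃ a '' S := Equiv.Set.image a S ha
    have hst : Disjoint (b '' T) (a '' S) := by
      rw [Set.disjoint_left]
      rintro _ ⟨e, -, rfl⟩ ⟨v, -, h⟩
      exact hdis v e h
    obtain ⟨M, hMv, hM⟩ := SimpleGraph.Subgraph.IsMatching.exists_of_disjoint_sets_of_equiv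
      (G := G) hst ((e1.symm.trans e2).trans e3) (by
        intro x
        obtain ⟨t, rfl⟩ := e1.surjective x
        have := ((hN _ _).1 (hadj t)).symm
        simpa [e1, e2, e3] using this)
    refine ⟨M, hM, ?_, by rw [hMv, Set.union_comm]⟩
    rw [hM.ncard_edgeSet_eq hG, ← hV2, hMv, Set.union_comm, hbT, hT]
  · rintro ⟨T, S⟩ ⟨T', S'⟩ - - h
    dsimp only at h
    rw [Prod.mk.injEq]
    exact ⟨by rw [← hbT T S, h, hbT], by rw [← haS T S, h, haS]⟩
  · rintro W ⟨M, hM, hk, rfl⟩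
    have hpar : ∀ t : b ⁻¹' M.verts, ∃ v, M.Adj (b t) (a v) := by
      intro t
      obtain ⟨y, hy⟩ := (hM t.2).exists
      rcases hG.mem_of_adj hy.adj_sub with ⟨h1, h2⟩ | ⟨h1, h2⟩
      · exact absurd (hmB t) (Set.disjoint_left.1 hG.disjoint h1)
      · rw [← har] at h2
        obtain ⟨v, rfl⟩ := h2
        exact ⟨v, hy⟩
    choose σ hσ using hpar
    refine ⟨(b ⁻¹' M.verts, a ⁻¹' M.verts), ⟨?_, σ, ?_, ?_, ?_⟩, ?_⟩
    · rw [← hk, hM.ncard_edgeSet_eq hG, hV2]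
    · intro t t' h
      have h1 := hσ t
      rw [h] at h1
      exact Subtype.ext (hb (hM.eq_of_adj_right h1 (hσ t')))
    · exact fun t => (hN _ _).2 (hσ t).adj_sub.symm
    · ext v
      constructor
      · rintro ⟨t, rfl⟩
        exact (hσ t).snd_mem
      · intro hv
        obtain ⟨y, hy⟩ := (hM hv).exists
        rcases hG.mem_of_adj hy.adj_sub with ⟨h1, h2⟩ | ⟨h1, h2⟩
        · rw [← hbr] at h2
          obtain ⟨e, rfl⟩ := h2
          refine ⟨⟨e, hy.snd_mem⟩, ?_⟩
          exact ha (hM.eq_of_adj_left (hσ ⟨e, hy.snd_mem⟩) hy.symm)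
        · exact absurd h1 (Set.disjoint_left.1 hG.disjoint (hmA v))
    · dsimp only
      rw [Set.image_preimage_eq_inter_range, Set.image_preimage_eq_inter_range, har, hbr,
        ← Set.inter_union_distrib_left, Set.inter_eq_left]
      intro x hx
      obtain ⟨y, hy⟩ := (hM hx).exists
      rcases hG.mem_of_adj hy.adj_sub with ⟨h1, h2⟩ | ⟨h1, h2⟩
      · exact Or.inl h1
      · exact Or.inr h1

end Matchings

/-! ### Fibre counts with prescribed support -/

section SupportCount

theorem Set.ncard_eq_of_fiberwise {X X' Y : Type*} {s : Set X} {s' : Set X'} (hs : s.Finite)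
    (hs' : s'.Finite) (π : X → Y) (π' : X' → Y)
    (h : ∀ y, {x | x ∈ s ∧ π x = y}.ncard = {x | x ∈ s' ∧ π' x = y}.ncard) :
    s.ncard = s'.ncard := by
  classical
  let t := hs.toFinset.image π ∪ hs'.toFinset.image π'
  rw [Set.ncard_eq_toFinset_card s hs, Set.ncard_eq_toFinset_card s' hs',
    Finset.card_eq_sum_card_fiberwise (f := π) (t := t),
    Finset.card_eq_sum_card_fiberwise (f := π') (t := t)]
  · refine Finset.sum_congr rfl fun y _ => ?_
    rw [← Set.ncard_coe_finset, ← Set.ncard_coe_finset]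
    simpa using h y
  · exact fun x hx => Finset.mem_coe.2 (Finset.mem_union_right _ (Finset.mem_image_of_mem _ hx))
  · exact fun x hx => Finset.mem_coe.2 (Finset.mem_union_left _ (Finset.mem_image_of_mem _ hx))

/-- If each element of `A` is related to `r`, then the fibre counts with a given support outside `r`
are equinumerous with the subsets of `A` matched perfectly to that support. -/
theorem ncard_fiberCount_with_support {A ε : Type*} [Finite A] [Finite ε] {N : A → ε → Prop} {r : ε}
    (hr : ∀ v, N v r) (T : Set {e // e ≠ r}) :
    {f : ε → ℕ | IsFiberCount N f ∧ {e : {e // e ≠ r} | f e ≠ 0} = T}.ncard =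
      {S : Set A | Saturates (fun v (e : T) => N v e) S}.ncard := by
  classical
  have := Fintype.ofFinite ε
  rw [← card_partialFiberCount_eq_card_saturates]
  refine Set.ncard_congr (fun f _ t => f t) ?_ ?_ ?_
  · rintro f ⟨⟨φ, hφ, hf⟩, hT⟩
    refine ⟨fun t => ?_, fun v => if h : ∃ t : T, φ v = t then some h.choose else none, ?_, ?_⟩
    · have : t.1 ∈ {e : {e // e ≠ r} | f e ≠ 0} := hT ▸ t.2
      exact this
    · intro v t h
      dsimp only at h
      split_ifs at h with h'
      have := h'.choose_spec
      rw [Option.some.inj h] at this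
      rw [← this]; exact hφ v
    · intro t
      dsimp only
      rw [hf]
      congr 1
      ext v
      simp only [Set.mem_ofPred_eq]
      constructor
      · intro h
        have h' : ∃ t : T, φ v = t := ⟨t, h⟩
        rw [dif_pos h', Option.some_inj]
        exact Subtype.ext (Subtype.ext (h'.choose_spec.symm.trans h))
      · intro h
        split_ifs at h with h'
        rw [← Option.some.inj h]
        exact h'.choose_spec
  · rintro f f' ⟨⟨φ, hφ, hf⟩, hT⟩ ⟨⟨φ', hφ', hf'⟩, hT'⟩ h
    have hne : ∀ e, e ≠ r → f e = f' e := by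
      intro e he
      by_cases heT : (⟨e, he⟩ : {e // e ≠ r}) ∈ T
      · exact congr_fun h ⟨_, heT⟩
      · have h1 : f e = 0 := by
          by_contra h0
          exact heT (hT ▸ h0)
        have h2 : f' e = 0 := by
          by_contra h0
          exact heT (hT' ▸ h0)
        rw [h1, h2]
    -- Both totals equal the size of `A`, which recovers the value at `r`.
    have hsum : ∑ e, f e = ∑ e, f' e := by
      simp only [hf, hf', sum_ncard_fiber, Finset.mem_univ]
    rw [← Finset.add_sum_erase _ _ (Finset.mem_univ r),
      ← Finset.add_sum_erase _ f' (Finset.mem_univ r),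
      Finset.sum_congr rfl fun e he => hne e (Finset.ne_of_mem_erase he)] at hsum
    ext e
    by_cases he : e = r
    · rw [he]; exact Nat.add_right_cancel hsum
    · exact hne e he
  · rintro g ⟨hg0, φ, hφ, hg⟩
    -- Elements without an image are sent to `r`, to which everything is related.
    let ψ : A → ε := fun v => (φ v).elim r fun t => t
    have hψ : ∀ v (t : T), ψ v = t ↔ φ v = some t := by
      intro v t
      cases h : φ v with
      | none => simp only [ψ, h, Option.elim_none, reduceCtorEq, iff_false]; exact t.1.2.symm
      | some t' => simp [ψ, h, Subtype.ext_iff]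
    have hcount : ∀ t : T, {v | ψ v = t}.ncard = g t := fun t => by rw [hg]; simp only [hψ]
    refine ⟨fun e => {v | ψ v = e}.ncard, ⟨⟨ψ, fun v => ?_, fun _ => rfl⟩, ?_⟩, funext hcount⟩
    · cases h : φ v with
      | none => simpa [ψ, h] using hr v
      | some t => simpa [ψ, h] using hφ v t h
    · ext e
      simp only [Set.mem_ofPred_eq]
      constructor
      · intro h
        obtain ⟨v, hv⟩ := Set.nonempty_of_ncard_ne_zero h
        have hv : ψ v = e := hv
        cases h' : φ v with
        | none => simp only [ψ, h', Option.elim_none] at hv; exact absurd hv.symm e.2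
        | some t =>
          simp only [ψ, h', Option.elim_some] at hv
          rw [← Subtype.ext hv]; exact t.2
      · intro he
        rw [hcount ⟨e, he⟩]
        exact hg0 _

end SupportCount

/-! ### The graph Ĝ and its labellings -/

section HatGraph

variable {V : Type*} {G : SimpleGraph V} {V₁ V₂ : Set V}

theorem hatGraph_adj_inl_inl {x y : V} :
    (hatGraph G V₁ V₂).Adj (Sum.inl x) (Sum.inl y) ↔ G.Adj x y := by
  simp only [hatGraph, SimpleGraph.fromEdgeSet_adj]
  constructor
  · rintro ⟨(⟨⟨u, w⟩, h, h'⟩ | ⟨i, -, h⟩) | ⟨i, -, h⟩, -⟩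
    · have h : G.Adj u w := h
      have h' : s((Sum.inl u : V ⊕ Fin 2), Sum.inl w) = s(Sum.inl x, Sum.inl y) := h'
      rcases Sym2.eq_iff.1 h' with ⟨h1, h2⟩ | ⟨h1, h2⟩
      · rwa [← Sum.inl.inj h1, ← Sum.inl.inj h2]
      · rw [← Sum.inl.inj h1, ← Sum.inl.inj h2]; exact h.symm
    · simp at h
    · simp at h
  · intro h
    exact ⟨Or.inl (Or.inl ⟨s(x, y), h, rfl⟩), fun h' => h.ne (Sum.inl.inj h')⟩

theorem hatGraph_adj_inl_inr_zero {x : V} :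
    (hatGraph G V₁ V₂).Adj (Sum.inl x) (Sum.inr 0) ↔ x ∈ V₁ := by
  simp only [hatGraph, SimpleGraph.fromEdgeSet_adj]
  constructor
  · rintro ⟨(⟨⟨u, w⟩, h, h'⟩ | ⟨_, ⟨y, hy, rfl⟩, h⟩) | ⟨i, -, h⟩, -⟩
    · have h' : s((Sum.inl u : V ⊕ Fin 2), Sum.inl w) = s(Sum.inl x, Sum.inr 0) := h'
      simp at h'
    · have : x = y := by simpa [Sym2.eq_iff] using h
      rwa [this]
    · simp at h
  · intro h
    exact ⟨Or.inl (Or.inr ⟨_, ⟨x, h, rfl⟩, rfl⟩), by simp⟩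

theorem hatGraph_adj_inl_inr_one {x : V} :
    (hatGraph G V₁ V₂).Adj (Sum.inl x) (Sum.inr 1) ↔ x ∈ V₂ := by
  simp only [hatGraph, SimpleGraph.fromEdgeSet_adj]
  constructor
  · rintro ⟨(⟨⟨u, w⟩, h, h'⟩ | ⟨i, -, h⟩) | ⟨_, ⟨y, hy, rfl⟩ | rfl, h⟩, -⟩
    · have h' : s((Sum.inl u : V ⊕ Fin 2), Sum.inl w) = s(Sum.inl x, Sum.inr 1) := h'
      simp at h'
    · simp at h
    · have : x = y := by simpa [Sym2.eq_iff] using h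
      rwa [this]
    · simp at h
  · intro h
    exact ⟨Or.inr ⟨_, Or.inl ⟨x, h, rfl⟩, rfl⟩, by simp⟩

theorem hatGraph_adj_inr_zero_inr_one :
    (hatGraph G V₁ V₂).Adj (Sum.inr 0) (Sum.inr 1) :=
  (SimpleGraph.fromEdgeSet_adj _).2 ⟨Or.inr ⟨_, Or.inr rfl, rfl⟩, by simp⟩

/-- Interchanging the two parts interchanges the two new vertices. -/
def hatGraphSwap (G : SimpleGraph V) (V₁ V₂ : Set V) : hatGraph G V₁ V₂ ≃g hatGraph G V₂ V₁ where
  toEquiv := Equiv.sumCongr (Equiv.refl V) (Equiv.swap 0 1)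
  map_rel_iff' := by
    have h01 : ∀ i : Fin 2, i = 0 ∨ i = 1 := by decide
    have key : ∀ i j : Fin 2, (hatGraph G V₂ V₁).Adj (Sum.inr (Equiv.swap 0 1 i))
        (Sum.inr (Equiv.swap 0 1 j)) ↔ (hatGraph G V₁ V₂).Adj (Sum.inr i) (Sum.inr j) := by
      intro i j
      rcases h01 i with rfl | rfl <;> rcases h01 j with rfl | rfl
      · simp
      · simp [hatGraph_adj_inr_zero_inr_one, hatGraph_adj_inr_zero_inr_one.symm]
      · simp [hatGraph_adj_inr_zero_inr_one, hatGraph_adj_inr_zero_inr_one.symm]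
      · simp
    have key' : ∀ x (i : Fin 2), (hatGraph G V₂ V₁).Adj (Sum.inl x) (Sum.inr (Equiv.swap 0 1 i)) ↔
        (hatGraph G V₁ V₂).Adj (Sum.inl x) (Sum.inr i) := by
      intro x i
      rcases h01 i with rfl | rfl
      · simp [hatGraph_adj_inl_inr_zero, hatGraph_adj_inl_inr_one]
      · simp [hatGraph_adj_inl_inr_zero, hatGraph_adj_inl_inr_one]
    rintro (x | i) (y | j)
    · exact hatGraph_adj_inl_inl.trans hatGraph_adj_inl_inl.symm
    · exact key' x j
    · rw [SimpleGraph.adj_comm, SimpleGraph.adj_comm _ (Sum.inr i)]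
      exact key' y i
    · exact key i j

end HatGraph

namespace MultiHypergraph

variable {V α ε : Type*} {H : MultiHypergraph α ε} {G : SimpleGraph V} {V₁ V₂ : Set V}

theorem not_bip_adj_inl_inl {v w : α} : ¬ H.bip.Adj (Sum.inl v) (Sum.inl w) := by
  simp [bip_adj_iff]

theorem not_bip_adj_inr_inr {e e' : ε} : ¬ H.bip.Adj (Sum.inr e) (Sum.inr e') := by
  simp [bip_adj_iff]

/-- A labelling of `Bip H` as the graph `Ĝ`, such that the new vertices are a vertex `s` in all
hyperedges and a hyperedge `r` with all vertices. -/
theorem exists_labelling (hV : V₁ ∪ V₂ = Set.univ)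
    (ψ : H.bip ≃g hatGraph G V₁ V₂) {r : ε} (hψr : ψ (Sum.inr r) = Sum.inr 0) :
    ∃ s : α, (∀ e, s ∈ H.edge e) ∧ (∀ v, v ∈ H.edge r) ∧
      ∃ (a : {v // v ≠ s} → V) (b : {e // e ≠ r} → V), Function.Injective a ∧
        Function.Injective b ∧ Set.range a = V₁ ∧ Set.range b = V₂ ∧
          ∀ v e, v.1 ∈ H.edge e.1 ↔ G.Adj (a v) (b e) := by
  have h01 : ∀ i : Fin 2, i = 0 ∨ i = 1 := by decide
  have hVx : ∀ x, x ∈ V₁ ∨ x ∈ V₂ := fun x => by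
    have : x ∈ V₁ ∪ V₂ := hV ▸ Set.mem_univ x
    exact this
  obtain ⟨s, hs⟩ : ∃ s, ψ (Sum.inl s) = Sum.inr 1 := by
    obtain ⟨y, hy⟩ := ψ.surjective (Sum.inr 1)
    rcases y with s | e
    · exact ⟨s, hy⟩
    · have := hatGraph_adj_inr_zero_inr_one (G := G) (V₁ := V₁) (V₂ := V₂)
      rw [← hψr, ← hy, ψ.map_adj_iff] at this
      exact absurd this not_bip_adj_inr_inr
  have ha : ∀ v : {v // v ≠ s}, ∃ x ∈ V₁, ψ (Sum.inl v.1) = Sum.inl x := by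
    rintro ⟨v, hv⟩
    dsimp only
    rcases h : ψ (Sum.inl v) with x | i
    · rcases hVx x with hx | hx
      · exact ⟨x, hx, rfl⟩
      · rw [← hatGraph_adj_inl_inr_one (G := G) (V₁ := V₁), ← h, ← hs, ψ.map_adj_iff] at hx
        exact absurd hx not_bip_adj_inl_inl
    · rcases h01 i with rfl | rfl
      · have := ψ.injective (h.trans hψr.symm)
        simp at this
      · have := ψ.injective (h.trans hs.symm)
        exact absurd (Sum.inl.inj this) hv
  have hb : ∀ e : {e // e ≠ r}, ∃ x ∈ V₂, ψ (Sum.inr e.1) = Sum.inl x := by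
    rintro ⟨e, he⟩
    dsimp only
    rcases h : ψ (Sum.inr e) with x | i
    · rcases hVx x with hx | hx
      · rw [← hatGraph_adj_inl_inr_zero (G := G) (V₂ := V₂), ← h, ← hψr, ψ.map_adj_iff] at hx
        exact absurd hx not_bip_adj_inr_inr
      · exact ⟨x, hx, rfl⟩
    · rcases h01 i with rfl | rfl
      · have := ψ.injective (h.trans hψr.symm)
        exact absurd (Sum.inr.inj this) he
      · have := ψ.injective (h.trans hs.symm)
        simp at this
  choose a ha1 ha2 using ha
  choose b hb1 hb2 using hb
  have hsr : s ∈ H.edge r := by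
    rw [← bip_adj_inl_inr, ← ψ.map_adj_iff, hs, hψr]
    exact hatGraph_adj_inr_zero_inr_one.symm
  refine ⟨s, fun e => ?_, fun v => ?_, a, b, ?_, ?_, ?_, ?_, ?_⟩
  · by_cases he : e = r
    · rwa [he]
    · rw [← bip_adj_inl_inr, ← ψ.map_adj_iff, hs, hb2 ⟨e, he⟩, SimpleGraph.adj_comm]
      exact hatGraph_adj_inl_inr_one.2 (hb1 _)
  · by_cases hv : v = s
    · rwa [hv]
    · rw [← bip_adj_inl_inr, ← ψ.map_adj_iff, hψr, ha2 ⟨v, hv⟩]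
      exact hatGraph_adj_inl_inr_zero.2 (ha1 _)
  · intro v w h
    refine Subtype.ext (Sum.inl.inj (ψ.injective ?_))
    rw [ha2, ha2, h]
  · intro v w h
    refine Subtype.ext (Sum.inr.inj (ψ.injective ?_))
    rw [hb2, hb2, h]
  · refine Set.Subset.antisymm (Set.range_subset_iff.2 ha1) fun x hx => ?_
    obtain ⟨y, hy⟩ := ψ.surjective (Sum.inl x)
    rcases y with v | e
    · have hv : v ≠ s := by
        rintro rfl
        rw [hs] at hy
        simp at hy
      exact ⟨⟨v, hv⟩, Sum.inl.inj ((ha2 ⟨v, hv⟩).symm.trans hy)⟩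
    · rw [← hatGraph_adj_inl_inr_zero (G := G) (V₂ := V₂), ← hy, ← hψr, ψ.map_adj_iff] at hx
      exact absurd hx not_bip_adj_inr_inr
  · refine Set.Subset.antisymm (Set.range_subset_iff.2 hb1) fun x hx => ?_
    obtain ⟨y, hy⟩ := ψ.surjective (Sum.inl x)
    rcases y with v | e
    · rw [← hatGraph_adj_inl_inr_one (G := G) (V₁ := V₁), ← hy, ← hs, ψ.map_adj_iff] at hx
      exact absurd hx not_bip_adj_inl_inl
    · have he : e ≠ r := by
        rintro rfl
        rw [hψr] at hy
        simp at hy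
      exact ⟨⟨e, he⟩, Sum.inl.inj ((hb2 ⟨e, he⟩).symm.trans hy)⟩
  · intro v e
    rw [← bip_adj_inl_inr, ← ψ.map_adj_iff, ha2, hb2, hatGraph_adj_inl_inl]

theorem interiorPolynomial_eq_of_labelling [Fintype V] [Finite α] [Finite ε] [LinearOrder ε]
    (hG : G.IsBipartiteWith V₁ V₂) (hV : V₁ ∪ V₂ = Set.univ)
    (ψ : H.bip ≃g hatGraph G V₁ V₂) {r : ε} (hψr : ψ (Sum.inr r) = Sum.inr 0) :
    H.interiorPolynomial =
      ∑ k ∈ Finset.range (Fintype.card V + 1),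
        C ((matchingVertexSets G k).ncard : ℤ) * X ^ k := by
  classical
  obtain ⟨s, hs, hr, a, b, ha, hb, har, hbr, hN⟩ := exists_labelling hV ψ hψr
  let N : {v // v ≠ s} → ε → Prop := fun v e => v.1 ∈ H.edge e
  have hsupp : ∀ f : ε → ℕ, {e | e ≠ r ∧ f e ≠ 0}.ncard = {e : {e // e ≠ r} | f e ≠ 0}.ncard := by
    intro f
    rw [← Set.ncard_image_of_injective _ Subtype.val_injective]
    congr 1
    ext e
    simp [and_comm]
  rw [interiorPolynomial_eq_sum_support hs hr]
  rw [← Finset.sum_fiberwise_of_maps_to (t := Finset.range (Fintype.card V + 1))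
    (g := fun f : ε → ℕ => {e | e ≠ r ∧ f e ≠ 0}.ncard)]
  swap
  · intro f _
    rw [hsupp, Finset.mem_range, Nat.lt_succ_iff, ← Set.ncard_image_of_injective _ hb,
      ← Nat.card_eq_fintype_card]
    exact Set.ncard_le_card _
  refine Finset.sum_congr rfl fun k _ => ?_
  rw [Finset.sum_congr rfl fun f hf => by rw [(Finset.mem_filter.1 hf).2], Finset.sum_const,
    nsmul_eq_mul]
  congr 1
  rw [← Set.ncard_coe_finset, ncard_matchingVertexSets hG ha hb har hbr hN k]
  -- Both sides are compared for each fixed `T`, the support of the hypertree outside `r` or the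
  -- part of the matched pair in `V₂`.
  have hcount : {f | f ∈ H.hypertrees ∧ {e | e ≠ r ∧ f e ≠ 0}.ncard = k}.ncard =
      {p : Set {e // e ≠ r} × Set {v // v ≠ s} | p.1.ncard = k ∧
        Saturates (fun v (e : p.1) => v.1 ∈ H.edge e.1.1) p.2}.ncard := by
    refine Set.ncard_eq_of_fiberwise (H.hypertrees_finite.subset fun f hf => hf.1) (Set.toFinite _)
      (fun f => {e : {e // e ≠ r} | f e ≠ 0}) Prod.fst fun T => ?_
    by_cases hT : T.ncard = k
    · trans {S : Set {v // v ≠ s} | Saturates (fun v (e : T) => N v e) S}.ncard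
      · rw [← ncard_fiberCount_with_support fun v => hr v.1]
        congr 1
        ext f
        simp only [Set.mem_ofPred_eq]
        rw [mem_hypertrees_iff hs, hsupp]
        constructor
        · rintro ⟨⟨h1, -⟩, h2⟩; exact ⟨h1, h2⟩
        · rintro ⟨h1, h2⟩; exact ⟨⟨h1, by rw [h2, hT]⟩, h2⟩
      · rw [← Set.ncard_image_of_injective _ (Prod.mk_right_injective T)]
        congr 1
        ext ⟨T', S⟩
        constructor
        · rintro ⟨S', h, h'⟩
          obtain ⟨rfl, rfl⟩ := Prod.mk.inj h'
          exact ⟨⟨hT, h⟩, rfl⟩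
        · rintro ⟨⟨h1, h2⟩, h3⟩
          dsimp only at h3
          subst h3
          exact ⟨S, h2, rfl⟩
    · have h1 : {f | f ∈ {f | f ∈ H.hypertrees ∧ {e | e ≠ r ∧ f e ≠ 0}.ncard = k} ∧
          {e : {e // e ≠ r} | f e ≠ 0} = T} = ∅ := by
        refine Set.eq_empty_of_forall_notMem ?_
        rintro f ⟨⟨-, h1⟩, h2⟩
        rw [hsupp, h2] at h1
        exact hT h1
      rw [h1]
      symm
      rw [Set.ncard_empty]
      have h2 : {p | p ∈ {p : Set {e // e ≠ r} × Set {v // v ≠ s} | p.1.ncard = k ∧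
          Saturates (fun v (e : p.1) => v.1 ∈ H.edge e.1.1) p.2} ∧ p.1 = T} = ∅ := by
        refine Set.eq_empty_of_forall_notMem ?_
        rintro p ⟨⟨h1, -⟩, h2⟩
        rw [h2] at h1
        exact hT h1
      rw [h2, Set.ncard_empty]
  rw [← hcount]
  simp

end MultiHypergraph

/-- The interior polynomial of `Ĝ` is computed from any hypergraph `H` with `Bip H ≅ Ĝ`, and with
any ordering of its hyperedges. No `k`-matching exists for `k` greater than the number of
vertices, so the sum is the sum over all `k ≥ 0`. -/
theorem proposition3p3 {V : Type*} [Fintype V] (G : SimpleGraph V) (V₁ V₂ : Set V)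
    (hG : G.IsBipartiteWith V₁ V₂) (hV : V₁ ∪ V₂ = Set.univ)
    {α ε : Type*} [Finite α] [Finite ε] [LinearOrder ε] (H : MultiHypergraph α ε)
    (hH : Nonempty (H.bip ≃g hatGraph G V₁ V₂)) :
    H.interiorPolynomial =
      ∑ k ∈ Finset.range (Fintype.card V + 1), C ((matchingVertexSets G k).ncard : ℤ) * X ^ k := by
  obtain ⟨ψ⟩ := hH
  obtain ⟨x | r, hx⟩ := ψ.surjective (Sum.inr 0)
  -- If `inr 0` comes from a vertex, its neighbour `inr 1` comes from a hyperedge, and interchanging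
  -- the parts turns `inr 1` into `inr 0`.
  · obtain ⟨y | r, hy⟩ := ψ.surjective (Sum.inr 1)
    · have := hatGraph_adj_inr_zero_inr_one (G := G) (V₁ := V₁) (V₂ := V₂)
      rw [← hx, ← hy, ψ.map_adj_iff] at this
      exact absurd this MultiHypergraph.not_bip_adj_inl_inl
    · refine MultiHypergraph.interiorPolynomial_eq_of_labelling hG.symm (by rwa [Set.union_comm])
        (ψ.trans (hatGraphSwap G V₁ V₂)) (r := r) ?_
      simp [hatGraphSwap, hy]
  · exact MultiHypergraph.interiorPolynomial_eq_of_labelling hG hV ψ hx
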